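/- Let $p$ be a prime, $K$ a finite extension of $\mathbb{Q}_p$ with its $p$-adic absolute value $|\cdot|$, and $R=\{x\in K:|x|\le 1\}$. For $n\ge 0$ let $$\mathbb{T}^\dagger_n=\Big\{\sum_{v\in\mathbb{N}^n}c_v\xi^v\in R[[\xi_1,\dots,\xi_n]]:\ \exists\,\varepsilon>0,\ |c_v|\,p^{\varepsilon|v|}\to 0\Big\},\qquad |v|=v_1+\dots+v_n.$$ An $R$-algebra is called weakly complete finitely generated (w.c.f.g.) if it is a quotient of some $\mathbb{T}^\dagger_n$. If $A=\mathbb{T}^\dagger_n/I_1$ and $B=\mathbb{T}^\dagger_m/I_2$ are w.c.f.g. algebras, their dagger completed tensor product is $A\hat\otimes^\dagger B=\mathbb{T}^\dagger_{n+m}/J$, where $J$ is the ideal generated by $I_1$ (placed in the first $n$ variables) and $I_2$ (placed in the last $m$ variables); for $a\in A$, $b\in B$ write $a\otimes 1$, $1\otimes b$ for their images under the natural maps $A\to A\hat\otimes^\dagger B$, $B\to A\hat\otimes^\dagger B$, and $a\otimes b=(a\otimes 1)(1\otimes b)$. Let $A$ be a w.c.f.g. algebra over $R$, and form $A\hat\otimes^\dagger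 A$ from any two presentations $\mathbb{T}^\dagger_n\twoheadrightarrow A$ and $\mathbb{T}^\dagger_m\twoheadrightarrow A$. Then there is a unique homomorphism of $R$-algebras $\mu:A\hat\otimes^\dagger A\to A$ with $\mu(b\otimes b')=bb'$ for all $b,b'\in A$. Let $I=\ker\mu$, regard $I/I^2$ as an $A$-module through $(A\hat\otimes^\dagger A)/I\cong A$, and let $d:A\to I/I^2$, $db=1\otimes b-b\otimes 1 \pmod{I^2}$, which is an $R$-derivation. Then $(I/I^2,d)$ is the module of differential forms $(\Omega^1_{A/R},d_{A/R})$ of $A$ over $R$; that is, $I/I^2$ is a finite $A$-module, and for every finite $A$-module $M$ the map $$\mathrm{Hom}_A(I/I^2,M)\to\mathrm{Der}_R(A,M),\qquad \varphi\mapsto\varphi\circ d,$$ is bijective. -/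

import Mathlib

universe u v w

open Filter Topology

noncomputable section

namespace DaggerAlg

/-- The valuation ring `R = {x ∈ K : |x| ≤ 1}` of a nonarchimedean normed field `K`; when `K` is a
finite extension of `ℚ_p` this is its ring of integers. -/
abbrev RInt (K : Type*) [NormedField K] [IsUltrametricDist K] : Subring K :=
  (NormedField.valuation (K := K)).integer

/-- A power series `∑ c_v ξ^v` over `R` is overconvergent if there is `ε > 0` such that
`|c_v| p^{ε|v|} → 0`, where `|v| = v_1 + ... + v_n`. -/
def Overconvergent (p : ℕ) (K : Type*) [NormedField K] [IsUltrametricDist K] {n : ℕ}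
    (f : MvPowerSeries (Fin n) (RInt K)) : Prop :=
  ∃ ε : ℝ, 0 < ε ∧
    Tendsto (fun v : Fin n →₀ ℕ =>
      ‖(MvPowerSeries.coeff v f : RInt K)‖ * (p : ℝ) ^ (ε * (v.degree : ℝ))) cofinite (𝓝 0)

section Overconvergent

variable {p : ℕ} {K : Type*} [NormedField K] [IsUltrametricDist K] {n : ℕ}

theorem overconvergent_C (r : RInt K) :
    Overconvergent p K (MvPowerSeries.C r : MvPowerSeries (Fin n) (RInt K)) := by
  classical
  refine ⟨1, one_pos, tendsto_nhds_of_eventually_eq ?_⟩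
  refine (Set.finite_singleton (0 : Fin n →₀ ℕ)).subset ?_
  intro v hv
  by_contra h0
  have h0' : v ≠ 0 := h0
  exact hv (by simp [MvPowerSeries.coeff_C, h0'])

theorem Overconvergent.rename {m : ℕ} (e : Fin n ↪ Fin m) {f : MvPowerSeries (Fin n) (RInt K)}
    (hf : Overconvergent p K f) : Overconvergent p K (MvPowerSeries.rename e f) := by
  obtain ⟨ε, hε, hf⟩ := hf
  refine ⟨ε, hε, ?_⟩
  rw [Metric.tendsto_nhds] at hf ⊢
  intro η hη
  have h := hf η hη
  rw [eventually_cofinite] at h ⊢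
  refine (h.image (Finsupp.mapDomain e)).subset ?_
  intro w hw
  by_cases hr : w ∈ Set.range (Finsupp.mapDomain e : (Fin n →₀ ℕ) → (Fin m →₀ ℕ))
  · obtain ⟨v, rfl⟩ := hr
    refine ⟨v, ?_, rfl⟩
    have hdeg : (Finsupp.mapDomain e v).degree = v.degree := by
      exact Finsupp.degree_mapDomain e v
    have hc := MvPowerSeries.coeff_embDomain_rename e f v
    rw [Finsupp.embDomain_eq_mapDomain] at hc
    simpa only [Set.mem_ofPred_eq, hdeg, hc] using hw
  · exact absurd hw (by simp [MvPowerSeries.coeff_rename_eq_zero _ f hr, hη])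

variable [hp : Fact p.Prime]

theorem overconvergent_shrink {f : MvPowerSeries (Fin n) (RInt K)} {ε δ : ℝ} (h : δ ≤ ε)
    (hf : Tendsto (fun v : Fin n →₀ ℕ =>
      ‖(MvPowerSeries.coeff v f : RInt K)‖ * (p : ℝ) ^ (ε * (v.degree : ℝ))) cofinite (𝓝 0)) :
    Tendsto (fun v : Fin n →₀ ℕ =>
      ‖(MvPowerSeries.coeff v f : RInt K)‖ * (p : ℝ) ^ (δ * (v.degree : ℝ))) cofinite (𝓝 0) := by
  have h1 : (1 : ℝ) ≤ p := by exact_mod_cast hp.out.one_le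
  refine tendsto_const_nhds.squeeze hf (fun v => by positivity) (fun v => ?_)
  refine mul_le_mul_of_nonneg_left ?_ (norm_nonneg _)
  exact Real.rpow_le_rpow_of_exponent_le h1 (mul_le_mul_of_nonneg_right h (by positivity))

theorem Overconvergent.add {f g : MvPowerSeries (Fin n) (RInt K)} (hf : Overconvergent p K f)
    (hg : Overconvergent p K g) : Overconvergent p K (f + g) := by
  obtain ⟨ε, hε, hf⟩ := hf
  obtain ⟨δ, hδ, hg⟩ := hg
  refine ⟨min ε δ, lt_min hε hδ, ?_⟩
  have hf' := overconvergent_shrink (min_le_left ε δ) hf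
  have hg' := overconvergent_shrink (min_le_right ε δ) hg
  refine tendsto_const_nhds.squeeze (by simpa using hf'.add hg') (fun v => by positivity)
    (fun v => ?_)
  rw [← add_mul, map_add]
  exact mul_le_mul_of_nonneg_right (norm_add_le _ _) (by positivity)

theorem Overconvergent.mul {f g : MvPowerSeries (Fin n) (RInt K)} (hf : Overconvergent p K f)
    (hg : Overconvergent p K g) : Overconvergent p K (f * g) := by
  classical
  obtain ⟨ε, hε, hf⟩ := hf
  obtain ⟨δ, hδ, hg⟩ := hg
  refine ⟨min ε δ, lt_min hε hδ, ?_⟩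
  have hp0 : (0 : ℝ) < p := by exact_mod_cast hp.out.pos
  simp only [MvPowerSeries.coeff_mul]
  refine MvPowerSeries.tendsto_antidiagonal
    (C := fun v : Fin n →₀ ℕ => (p : ℝ) ^ (min ε δ * (v.degree : ℝ))) (fun a b => ?_)
    (overconvergent_shrink (min_le_left ε δ) hf) (overconvergent_shrink (min_le_right ε δ) hg)
  rw [← Real.rpow_add hp0, map_add]
  push_cast
  ring_nf

end Overconvergent

/-- The algebra `T_n^†` of overconvergent power series in `n` variables over `R`. -/
def T (p : ℕ) [Fact p.Prime] (K : Type*) [NormedField K] [IsUltrametricDist K] (n : ℕ) :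
    Subalgebra (RInt K) (MvPowerSeries (Fin n) (RInt K)) where
  carrier := {f | Overconvergent p K f}
  mul_mem' := Overconvergent.mul
  add_mem' := Overconvergent.add
  algebraMap_mem' := overconvergent_C

/-- The homomorphism `T_n^† → T_m^†` that sends the variable `ξ_i` to `ξ_{e i}`. -/
def T.rename (p : ℕ) [Fact p.Prime] (K : Type*) [NormedField K] [IsUltrametricDist K] {n m : ℕ}
    (e : Fin n ↪ Fin m) : T p K n →ₐ[RInt K] T p K m :=
  ((MvPowerSeries.rename e).comp (T p K n).val).codRestrict (T p K m)
    (fun f => Overconvergent.rename e f.2)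

/-- A presentation of the `R`-algebra `A` as a homomorphic image of some `T_n^†`; `A` is weakly
complete finitely generated (w.c.f.g.) if it has one. -/
structure Presentation (p : ℕ) [Fact p.Prime] (K : Type*) [NormedField K] [IsUltrametricDist K]
    (A : Type*) [CommRing A] [Algebra (RInt K) A] where
  n : ℕ
  toHom : T p K n →ₐ[RInt K] A
  surjective : Function.Surjective toHom

section Tensor

variable {p : ℕ} [Fact p.Prime] {K : Type*} [NormedField K] [IsUltrametricDist K]
  {A : Type*} [CommRing A] [Algebra (RInt K) A] {B : Type*} [CommRing B] [Algebra (RInt K) B]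

/-- For `A = T_n^†/I₁` and `B = T_m^†/I₂`: the ideal of `T_{n+m}^†` generated by `I₁`, in the first
`n` variables, and `I₂`, in the last `m` variables. -/
def tensorIdeal (P : Presentation p K A) (Q : Presentation p K B) : Ideal (T p K (P.n + Q.n)) :=
  Ideal.map (T.rename p K (Fin.castAddEmb Q.n)) (RingHom.ker P.toHom) ⊔
    Ideal.map (T.rename p K (Fin.natAddEmb P.n)) (RingHom.ker Q.toHom)

/-- The dagger completed tensor product `A ⊗̂† B` over `R`. -/
def DaggerTensor (P : Presentation p K A) (Q : Presentation p K B) : Type _ :=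
  T p K (P.n + Q.n) ⧸ tensorIdeal P Q

instance (P : Presentation p K A) (Q : Presentation p K B) : CommRing (DaggerTensor P Q) :=
  inferInstanceAs (CommRing (T p K (P.n + Q.n) ⧸ tensorIdeal P Q))

instance (P : Presentation p K A) (Q : Presentation p K B) :
    Algebra (RInt K) (DaggerTensor P Q) :=
  inferInstanceAs (Algebra (RInt K) (T p K (P.n + Q.n) ⧸ tensorIdeal P Q))

/-- The quotient homomorphism `T_{n+m}^† → A ⊗̂† B`. -/
def DaggerTensor.mk (P : Presentation p K A) (Q : Presentation p K B) :
    T p K (P.n + Q.n) →ₐ[RInt K] DaggerTensor P Q :=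
  Ideal.Quotient.mkₐ (RInt K) (tensorIdeal P Q)

theorem DaggerTensor.mk_eq_zero (P : Presentation p K A) (Q : Presentation p K B)
    {f : T p K (P.n + Q.n)} (hf : f ∈ tensorIdeal P Q) : DaggerTensor.mk P Q f = 0 :=
  Ideal.Quotient.eq_zero_iff_mem.mpr hf

/-- The homomorphism `A → A ⊗̂† B`, `a ↦ a ⊗ 1`. -/
def inl (P : Presentation p K A) (Q : Presentation p K B) : A →ₐ[RInt K] DaggerTensor P Q :=
  (Ideal.Quotient.liftₐ (RingHom.ker P.toHom)
    ((DaggerTensor.mk P Q).comp (T.rename p K (Fin.castAddEmb Q.n)))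
    (fun _ ha => DaggerTensor.mk_eq_zero P Q
      (Ideal.mem_sup_left (Ideal.mem_map_of_mem _ ha)))).comp
  (Ideal.quotientKerAlgEquivOfSurjective P.surjective).symm.toAlgHom

/-- The homomorphism `B → A ⊗̂† B`, `b ↦ 1 ⊗ b`. -/
def inr (P : Presentation p K A) (Q : Presentation p K B) : B →ₐ[RInt K] DaggerTensor P Q :=
  (Ideal.Quotient.liftₐ (RingHom.ker Q.toHom)
    ((DaggerTensor.mk P Q).comp (T.rename p K (Fin.natAddEmb P.n)))
    (fun _ hb => DaggerTensor.mk_eq_zero P Q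
      (Ideal.mem_sup_right (Ideal.mem_map_of_mem _ hb)))).comp
  (Ideal.quotientKerAlgEquivOfSurjective Q.surjective).symm.toAlgHom

/-- On `P.toHom f`, `inl` is the class of `f` in the first variables. -/
theorem inl_toHom (P : Presentation p K A) (Q : Presentation p K B) (f : T p K P.n) :
    inl P Q (P.toHom f) =
      DaggerTensor.mk P Q (T.rename p K (Fin.castAddEmb Q.n) f) := by
  have h : (Ideal.quotientKerAlgEquivOfSurjective P.surjective).symm (P.toHom f) =
      Ideal.Quotient.mk _ f := by
    rw [AlgEquiv.symm_apply_eq]; rfl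
  simp only [inl, AlgHom.comp_apply]
  erw [h]
  rfl

/-- On `Q.toHom f`, `inr` is the class of `f` in the last variables. -/
theorem inr_toHom (P : Presentation p K A) (Q : Presentation p K B) (f : T p K Q.n) :
    inr P Q (Q.toHom f) =
      DaggerTensor.mk P Q (T.rename p K (Fin.natAddEmb P.n) f) := by
  have h : (Ideal.quotientKerAlgEquivOfSurjective Q.surjective).symm (Q.toHom f) =
      Ideal.Quotient.mk _ f := by
    rw [AlgEquiv.symm_apply_eq]; rfl
  simp only [inr, AlgHom.comp_apply]
  erw [h]
  rfl

end Tensor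

section Diagonal

variable {p : ℕ} [Fact p.Prime] {K : Type*} [NormedField K] [IsUltrametricDist K]
  {A : Type*} [CommRing A] [Algebra (RInt K) A] {P Q : Presentation p K A}

/-- `m : A ⊗̂† A → A` is the multiplication (diagonal) homomorphism: `m (b ⊗ b') = b b'`. -/
def IsDiagonal (m : DaggerTensor P Q →ₐ[RInt K] A) : Prop :=
  ∀ b b' : A, m (inl P Q b * inr P Q b') = b * b'

/-- The quotient `I/I²`, where `I` is the kernel of `m`. -/
def Conormal (m : DaggerTensor P Q →ₐ[RInt K] A) : Type _ :=
  (RingHom.ker m).Cotangent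

instance (m : DaggerTensor P Q →ₐ[RInt K] A) : AddCommGroup (Conormal m) :=
  inferInstanceAs (AddCommGroup (RingHom.ker m).Cotangent)

instance (m : DaggerTensor P Q →ₐ[RInt K] A) : Module (DaggerTensor P Q) (Conormal m) :=
  inferInstanceAs (Module (DaggerTensor P Q) (RingHom.ker m).Cotangent)

/-- `A` acts on `I/I²` through `a ↦ a ⊗ 1`; for the diagonal homomorphism this is the action through
`A ≅ (A ⊗̂† A)/I`, see `Conormal.smul_eq`. -/
instance (m : DaggerTensor P Q →ₐ[RInt K] A) : Module A (Conormal m) :=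
  Module.compHom (Conormal m) (inl P Q : A →+* DaggerTensor P Q)

instance (m : DaggerTensor P Q →ₐ[RInt K] A) : Module (RInt K) (Conormal m) :=
  Module.compHom (Conormal m) (algebraMap (RInt K) A)

instance (m : DaggerTensor P Q →ₐ[RInt K] A) : IsScalarTower (RInt K) A (Conormal m) :=
  ⟨fun r a x => by
    rw [Algebra.smul_def, mul_smul]
    rfl⟩

/-- The class in `I/I²` of an element of `I`. -/
def Conormal.mk (m : DaggerTensor P Q →ₐ[RInt K] A) :
    RingHom.ker m →ₗ[DaggerTensor P Q] Conormal m :=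
  (RingHom.ker m).toCotangent

theorem IsDiagonal.inl {m : DaggerTensor P Q →ₐ[RInt K] A} (hm : IsDiagonal m) (a : A) :
    m (inl P Q a) = a := by
  simpa using hm a 1

theorem IsDiagonal.inr {m : DaggerTensor P Q →ₐ[RInt K] A} (hm : IsDiagonal m) (a : A) :
    m (inr P Q a) = a := by
  simpa using hm 1 a

theorem Conormal.smul_def (m : DaggerTensor P Q →ₐ[RInt K] A) (a : A) (x : Conormal m) :
    a • x = DaggerAlg.inl P Q a • x := rfl

theorem Conormal.smul_eq {m : DaggerTensor P Q →ₐ[RInt K] A} (hm : IsDiagonal m)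
    (s : DaggerTensor P Q) (x : Conormal m) : m s • x = s • x := by
  rw [Conormal.smul_def, ← sub_eq_zero, ← sub_smul]
  exact Ideal.Cotangent.smul_eq_zero_of_mem (I := RingHom.ker m)
    (by rw [RingHom.mem_ker, map_sub, hm.inl, sub_self]) x

theorem IsDiagonal.sub_mem {m : DaggerTensor P Q →ₐ[RInt K] A} (hm : IsDiagonal m) (b : A) :
    DaggerAlg.inr P Q b - DaggerAlg.inl P Q b ∈ RingHom.ker m := by
  rw [RingHom.mem_ker, map_sub, hm.inl, hm.inr, sub_self]

/-- The `R`-derivation `d : A → I/I²`, `d b = 1 ⊗ b - b ⊗ 1 (mod I²)`. -/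
def Conormal.d {m : DaggerTensor P Q →ₐ[RInt K] A} (hm : IsDiagonal m) :
    Derivation (RInt K) A (Conormal m) :=
  Derivation.mk'
    { toFun := fun b =>
        Conormal.mk m ⟨DaggerAlg.inr P Q b - DaggerAlg.inl P Q b, hm.sub_mem b⟩
      map_add' := fun a b => by
        rw [← map_add]
        congr 1
        ext1
        simp only [map_add, Submodule.coe_add]
        ring
      map_smul' := fun r a => by
        change _ = (algebraMap (RInt K) A r) • (Conormal.mk m _ : Conormal m)
        rw [Conormal.smul_def, ← map_smul]
        congr 1
        ext1
        simp only [AlgHom.commutes, Submodule.coe_smul, smul_eq_mul, Algebra.smul_def, map_mul]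
        ring }
    (fun a b => by
      change Conormal.mk m ⟨_, hm.sub_mem (a * b)⟩ =
        a • (Conormal.mk m ⟨_, hm.sub_mem b⟩ : Conormal m) +
          b • (Conormal.mk m ⟨_, hm.sub_mem a⟩ : Conormal m)
      have hb : ∀ x : Conormal m, b • x = DaggerAlg.inr P Q b • x := fun x => by
        rw [← Conormal.smul_eq hm, hm.inr]
      rw [hb, Conormal.smul_def, ← map_smul, ← map_smul, ← map_add]
      congr 1
      ext1
      simp only [map_mul, Submodule.coe_add, Submodule.coe_smul, smul_eq_mul]
      ring)

theorem Conormal.d_apply {m : DaggerTensor P Q →ₐ[RInt K] A} (hm : IsDiagonal m) (b : A) :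
    Conormal.d hm b =
      Conormal.mk m ⟨DaggerAlg.inr P Q b - DaggerAlg.inl P Q b, hm.sub_mem b⟩ := rfl

end Diagonal

/-- `(Ω, d)` is the module of differential forms of `A` over `R`: `Ω` is a finite `A`-module, and
for every finite `A`-module `M` the map `Hom_A(Ω, M) → Der_R(A, M)`, `φ ↦ φ ∘ d`, is bijective. -/
def IsModuleOfDifferentials.{u₁, u₂, u₃, u₄} {R : Type u₁} [CommRing R] {A : Type u₂} [CommRing A]
    [Algebra R A] {Ω : Type u₃} [AddCommGroup Ω] [Module A Ω] [Module R Ω] [IsScalarTower R A Ω]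
    (d : Derivation R A Ω) : Prop :=
  Module.Finite A Ω ∧
    ∀ (M : Type u₄) [AddCommGroup M] [Module A M] [Module R M] [IsScalarTower R A M],
      Module.Finite A M → Function.Bijective (fun φ : Ω →ₗ[A] M => φ.compDer d)

end DaggerAlg

end

/-!
Write `R` for the valuation ring, `T_n` for `T_n^†`, `D` for `A ⊗̂† A` and `I` for the kernel of the
diagonal homomorphism. Once w.c.f.g. algebras are known to be Noetherian, with `p` in their Jacobson
radical, the proof is that of the corresponding statement for finitely generated algebras.

*Separatedness.* Modulo every power of `p`, an overconvergent series is a polynomial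
(`T.exists_ofPoly_add`). By Krull's intersection theorem, finite modules over a w.c.f.g. algebra are
`p`-adically separated, so that additive maps from `T_n` into them are determined by their values on
polynomials (`Presentation.addMonoidHom_eq_zero`); homomorphisms and derivations are thus determined
by their values on the variables.

*Noetherianity* (`T.isNoetherianRing`). By Cohen's theorem it suffices to consider prime ideals. One
that contains `p` is generated by polynomials. For one that does not, the argument is that of
Gröbner bases: by Dickson's lemma finitely many elements have leading exponents, lexicographically
and modulo the maximal ideal of `R`, that divide all others, and these elements generate, by
division with remainder. The lexicographic order of finitely many exponents is realised by weights
of the variables. In a Gauss norm with these weights and a radius slightly greater than `1`, the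
divisors are small perturbations of their leading terms, so that the division follows by successive
approximation from the trivial division by monomials (`T.exists_division`). The division by
`1 + p f`, whose leading exponent is `0`, shows that `p` is in the Jacobson radical.

*The diagonal homomorphism* (`exists_isDiagonal`). Overconvergent series can be evaluated at
arbitrary elements of `T_n` (`T.eval`), hence at arbitrary elements of `A`. The homomorphism
`T_{n+m} → A` that sends the variables to their images under the two presentations extends both
presentations, and so it factors through `D`.

*Differentials.* `I` is generated by the elements `1 ⊗ b - b ⊗ 1`: with polynomials in place of
series this is the usual computation, so that it holds modulo `p I`, and Nakayama's lemma applies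
(`ker_le_diagonalIdeal`). This gives the injectivity of `φ ↦ φ ∘ d`. For the surjectivity, a
derivation `δ : A → M` is extended to a derivation on `D` by differentiating with respect to the
last `m` variables (`exists_extend_derivation`); its restriction to `I` vanishes on `I²`.
-/

noncomputable section

namespace DaggerAlg

/-! ### The valuation ring -/

section ValuationRing

variable {K : Type*} [NormedField K] [IsUltrametricDist K]

theorem RInt.norm_le_one (x : RInt K) : ‖x‖ ≤ 1 := by
  have h := (Valuation.mem_integer_iff _ _).1 x.2
  rw [NormedField.valuation_apply] at h
  exact_mod_cast h

theorem RInt.norm_mul (x y : RInt K) : ‖x * y‖ = ‖x‖ * ‖y‖ :=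
  _root_.norm_mul (x : K) (y : K)

theorem RInt.norm_pow (x : RInt K) (k : ℕ) : ‖x ^ k‖ = ‖x‖ ^ k :=
  _root_.norm_pow (x : K) k

theorem RInt.norm_sum_le {ι : Type*} (s : Finset ι) (f : ι → RInt K) {C : ℝ} (hC : 0 ≤ C)
    (h : ∀ i ∈ s, ‖f i‖ ≤ C) : ‖∑ i ∈ s, f i‖ ≤ C := by
  have := IsUltrametricDist.norm_sum_le_of_forall_le_of_nonneg (M := K) (s := s)
    (f := fun i => (f i : K)) hC h
  change ‖((∑ i ∈ s, f i : RInt K) : K)‖ ≤ C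
  simpa using this

theorem RInt.exists_eq_mul {a b : RInt K} (ha : a ≠ 0) (h : ‖b‖ ≤ ‖a‖) : ∃ c, b = a * c := by
  have ha' : (a : K) ≠ 0 := fun h0 => ha (Subtype.ext h0)
  refine ⟨⟨(a : K)⁻¹ * b, ?_⟩, ?_⟩
  · rw [Valuation.mem_integer_iff, NormedField.valuation_apply, ← NNReal.coe_le_coe, coe_nnnorm,
      _root_.norm_mul, norm_inv, inv_mul_le_iff₀ (norm_pos_iff.2 ha')]
    simpa using h
  · exact Subtype.ext (by simp [ha'])

variable (K) in
theorem RInt.coe_eq_closedBall : ((RInt K : Subring K) : Set K) = Metric.closedBall 0 1 := by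
  ext x
  rw [SetLike.mem_coe, Valuation.mem_integer_iff, NormedField.valuation_apply,
    ← NNReal.coe_le_coe, coe_nnnorm]
  simp

theorem RInt.completeSpace [CompleteSpace K] : CompleteSpace (RInt K) := by
  have h : IsClosed ((RInt K : Subring K) : Set K) := by
    rw [RInt.coe_eq_closedBall]
    exact Metric.isClosed_closedBall
  exact h.completeSpace_coe

variable (p : ℕ) [Fact p.Prime] [NormedAlgebra ℚ_[p] K]

theorem RInt.norm_p : ‖((p : ℕ) : RInt K)‖ = (p : ℝ)⁻¹ := by
  have h : ‖algebraMap ℚ_[p] K p‖ = (p : ℝ)⁻¹ := by rw [norm_algebraMap']; exact Padic.norm_p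
  rw [map_natCast] at h
  exact h

theorem RInt.norm_p_pos : 0 < ‖((p : ℕ) : RInt K)‖ := by
  rw [RInt.norm_p]
  exact inv_pos.2 (by exact_mod_cast (Fact.out : p.Prime).pos)

theorem RInt.norm_p_lt_one : ‖((p : ℕ) : RInt K)‖ < 1 := by
  rw [RInt.norm_p]
  exact inv_lt_one_of_one_lt₀ (by exact_mod_cast (Fact.out : p.Prime).one_lt)

theorem RInt.p_ne_zero : ((p : ℕ) : RInt K) ≠ 0 := norm_pos_iff.1 (RInt.norm_p_pos p)

/-- The valuation ring is compact, as `K` is locally compact, so that its ideals are principal. -/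
theorem RInt.isNoetherianRing [FiniteDimensional ℚ_[p] K] : IsNoetherianRing (RInt K) := by
  let _ : NontriviallyNormedField K :=
    { (inferInstance : NormedField K) with
      non_trivial := by
        obtain ⟨x, hx⟩ := NormedField.exists_one_lt_norm ℚ_[p]
        exact ⟨algebraMap ℚ_[p] K x, by rwa [norm_algebraMap']⟩ }
  have : ProperSpace K := FiniteDimensional.proper ℚ_[p] K
  let _ : Valued K NNReal := NormedField.toValued
  have h : IsCompact ((RInt K : Subring K) : Set K) := by
    rw [RInt.coe_eq_closedBall]
    exact isCompact_closedBall _ _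
  have : CompactSpace (RInt K) := isCompact_iff_compactSpace.1 h
  have : IsPrincipalIdealRing (RInt K) :=
    Valued.integer.isPrincipalIdealRing_of_compactSpace (K := K)
  infer_instance

end ValuationRing

/-! ### Gauss bounds and overconvergence -/

section GaussBound

variable {K : Type*} [NormedField K] [IsUltrametricDist K] {n : ℕ}

/-- `GaussBound wt ρ C f` says that the Gauss norm `sup_v |c_v| ρ^{wt v}` of the power series
`f = ∑ c_v ξ^v` is at most `C`. The variable `ξ_i` has radius `ρ^{wt e_i}`. -/
def GaussBound (wt : (Fin n →₀ ℕ) →+ ℕ) (ρ C : ℝ) (f : MvPowerSeries (Fin n) (RInt K)) : Prop :=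
  ∀ v, ‖MvPowerSeries.coeff v f‖ * ρ ^ wt v ≤ C

variable {wt : (Fin n →₀ ℕ) →+ ℕ} {ρ C D : ℝ} {f g : MvPowerSeries (Fin n) (RInt K)}

theorem GaussBound.nonneg (hρ : 0 ≤ ρ) (hf : GaussBound wt ρ C f) : 0 ≤ C :=
  (by positivity : 0 ≤ ‖MvPowerSeries.coeff 0 f‖ * ρ ^ wt 0).trans (hf 0)

theorem GaussBound.mono (hf : GaussBound wt ρ C f) (h : C ≤ D) : GaussBound wt ρ D f :=
  fun v => (hf v).trans h

theorem GaussBound.neg (hf : GaussBound wt ρ C f) : GaussBound wt ρ C (-f) := fun v => by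
  simpa using hf v

theorem GaussBound.sum (hρ : 0 < ρ) (hC : 0 ≤ C) {ι : Type*} (s : Finset ι)
    {F : ι → MvPowerSeries (Fin n) (RInt K)} (h : ∀ i ∈ s, GaussBound wt ρ C (F i)) :
    GaussBound wt ρ C (∑ i ∈ s, F i) := fun v => by
  have hv : 0 < ρ ^ wt v := by positivity
  rw [map_sum, ← le_div_iff₀ hv]
  exact RInt.norm_sum_le _ _ (by positivity) fun i hi => (le_div_iff₀ hv).2 (h i hi v)

theorem GaussBound.mul (hρ : 0 < ρ) (hf : GaussBound wt ρ C f) (hg : GaussBound wt ρ D g) :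
    GaussBound wt ρ (C * D) (f * g) := fun v => by
  classical
  have hC := hf.nonneg hρ.le
  have hD := hg.nonneg hρ.le
  have hv : 0 < ρ ^ wt v := by positivity
  rw [MvPowerSeries.coeff_mul, ← le_div_iff₀ hv]
  refine RInt.norm_sum_le _ _ (by positivity) fun i hi => (le_div_iff₀ hv).2 ?_
  rw [← Finset.HasAntidiagonal.mem_antidiagonal.1 hi, map_add, pow_add, RInt.norm_mul]
  calc _ = (‖MvPowerSeries.coeff i.1 f‖ * ρ ^ wt i.1) *
        (‖MvPowerSeries.coeff i.2 g‖ * ρ ^ wt i.2) := by ring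
    _ ≤ C * D := mul_le_mul (hf _) (hg _) (by positivity) hC

theorem gaussBound_one : GaussBound wt ρ 1 (1 : MvPowerSeries (Fin n) (RInt K)) := fun v => by
  classical
  rw [MvPowerSeries.coeff_one]
  split_ifs with h
  · simp [h]
  · simp

theorem GaussBound.pow (hρ : 0 < ρ) (hf : GaussBound wt ρ C f) (k : ℕ) :
    GaussBound wt ρ (C ^ k) (f ^ k) := by
  induction k with
  | zero => simpa using gaussBound_one
  | succ k ih => simpa only [pow_succ] using ih.mul hρ hf

theorem weight_le_mul_degree (wt : (Fin n →₀ ℕ) →+ ℕ) :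
    ∃ B : ℕ, ∀ v, wt v ≤ B * v.degree := by
  refine ⟨∑ i, wt (Finsupp.single i 1), fun v => ?_⟩
  have h : wt v = ∑ i, v i * wt (Finsupp.single i 1) := by
    conv_lhs => rw [← Finsupp.univ_sum_single v, map_sum]
    refine Finset.sum_congr rfl fun i _ => ?_
    rw [← smul_eq_mul, ← map_nsmul, Finsupp.smul_single_one]
  rw [h, Finsupp.degree_eq_sum, Finset.mul_sum]
  refine Finset.sum_le_sum fun i _ => ?_
  rw [mul_comm]
  exact Nat.mul_le_mul_right _
    (Finset.single_le_sum (f := fun i => wt (Finsupp.single i 1)) (by simp) (Finset.mem_univ i))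

theorem tendsto_pow_degree {r : ℝ} (h0 : 0 ≤ r) (h1 : r < 1) :
    Tendsto (fun v : Fin n →₀ ℕ => r ^ v.degree) cofinite (𝓝 0) := by
  refine (tendsto_pow_atTop_nhds_zero_of_lt_one h0 h1).comp ?_
  rw [tendsto_atTop]
  intro b
  rw [eventually_cofinite]
  refine (Finsupp.finite_of_degree_le (σ := Fin n) b).subset fun v hv => ?_
  simp only [Set.mem_ofPred_eq, not_le] at hv ⊢
  exact hv.le

end GaussBound

section Overconvergent

variable {p : ℕ} {K : Type*} [NormedField K] [IsUltrametricDist K] {n : ℕ}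
  {f g : MvPowerSeries (Fin n) (RInt K)}

theorem Overconvergent.of_norm_coeff_le (hf : Overconvergent p K f) {C : ℝ}
    (h : ∀ v, ‖MvPowerSeries.coeff v g‖ ≤ C * ‖MvPowerSeries.coeff v f‖) :
    Overconvergent p K g := by
  obtain ⟨ε, hε, hf⟩ := hf
  have hlim := hf.const_mul C
  rw [mul_zero] at hlim
  refine ⟨ε, hε, squeeze_zero (fun v => by positivity) (fun v => ?_) hlim⟩
  rw [← mul_assoc]
  exact mul_le_mul_of_nonneg_right (h v) (by positivity)

theorem Overconvergent.of_C_mul {a : RInt K} (ha : a ≠ 0)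
    (hf : Overconvergent p K (MvPowerSeries.C a * f)) : Overconvergent p K f := by
  refine hf.of_norm_coeff_le (C := ‖a‖⁻¹) fun v => ?_
  rw [MvPowerSeries.coeff_C_mul, RInt.norm_mul, inv_mul_cancel_left₀ (norm_ne_zero_iff.2 ha)]

theorem overconvergent_coe (q : MvPolynomial (Fin n) (RInt K)) :
    Overconvergent p K (q : MvPowerSeries (Fin n) (RInt K)) := by
  refine ⟨1, one_pos, tendsto_nhds_of_eventually_eq ?_⟩
  refine q.support.finite_toSet.subset fun v hv => ?_
  by_contra h0
  refine hv ?_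
  have : q.coeff v = 0 := by simpa using h0
  simp [this]

variable [hp : Fact p.Prime]

theorem one_lt_cast_prime (p : ℕ) [hp : Fact p.Prime] : (1 : ℝ) < p := by
  exact_mod_cast hp.out.one_lt

/-- A finite Gauss norm at a radius greater than `1` implies overconvergence. -/
theorem GaussBound.overconvergent {wt : (Fin n →₀ ℕ) →+ ℕ} (hwt : ∀ v, v.degree ≤ wt v)
    {ρ C : ℝ} (hρ : 1 < ρ) (hf : GaussBound wt ρ C f) : Overconvergent p K f := by
  have hp1 := one_lt_cast_prime p
  have hp0 : (0 : ℝ) < p := zero_lt_one.trans hp1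
  have hρ0 : 0 < ρ := zero_lt_one.trans hρ
  -- `p ^ ε` is the square root of `ρ`
  refine ⟨Real.logb p ρ / 2, half_pos (Real.logb_pos hp1 hρ), ?_⟩
  set s : ℝ := (p : ℝ) ^ (Real.logb p ρ / 2) with hs
  have hs2 : s ^ 2 = ρ := by
    rw [hs, ← Real.rpow_natCast, ← Real.rpow_mul hp0.le]
    simp [Real.rpow_logb hp0 hp1.ne' hρ0]
  have hs0 : 0 < s := by positivity
  have hs1 : 1 < s := by
    by_contra h
    have : s ^ 2 ≤ 1 := pow_le_one₀ hs0.le (not_lt.1 h)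
    linarith
  have hlim := (tendsto_pow_degree (n := n) (inv_nonneg.2 hs0.le)
    (inv_lt_one_of_one_lt₀ hs1)).const_mul C
  rw [mul_zero] at hlim
  refine squeeze_zero (fun v => by positivity) (fun v => ?_) hlim
  rw [Real.rpow_mul hp0.le, ← hs, Real.rpow_natCast, inv_pow, ← div_eq_mul_inv,
    le_div_iff₀ (by positivity), mul_assoc, ← pow_add, ← two_mul, pow_mul, hs2]
  exact (mul_le_mul_of_nonneg_left (pow_le_pow_right₀ hρ.le (hwt v)) (norm_nonneg _)).trans (hf v)

/-- As the radius tends to `1`, the Gauss norm of the part of an overconvergent series that consists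
of the terms with coefficients smaller than `η` becomes at most `η`. -/
theorem Overconvergent.eventually_le (hf : Overconvergent p K f) (wt : (Fin n →₀ ℕ) →+ ℕ)
    {η : ℝ} (hη : 0 < η) :
    ∀ᶠ ρ in 𝓝[>] (1 : ℝ), ∀ v, ‖MvPowerSeries.coeff v f‖ < η →
      ‖MvPowerSeries.coeff v f‖ * ρ ^ wt v ≤ η := by
  obtain ⟨ε, hε, hf⟩ := hf
  obtain ⟨B, hB⟩ := weight_le_mul_degree wt
  have hp1 := one_lt_cast_prime p
  have hp0 : (0 : ℝ) < p := zero_lt_one.trans hp1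
  have hfin := (eventually_cofinite.1 (hf.eventually (gt_mem_nhds hη)))
  have h1 : ∀ᶠ ρ in 𝓝[>] (1 : ℝ), ρ ^ B < (p : ℝ) ^ ε := by
    refine nhdsWithin_le_nhds ?_
    have : Tendsto (fun ρ : ℝ => ρ ^ B) (𝓝 1) (𝓝 (1 ^ B)) := (continuous_pow B).tendsto 1
    exact this.eventually (gt_mem_nhds (by simpa using Real.one_lt_rpow hp1 hε))
  have h2 : ∀ᶠ ρ in 𝓝[>] (1 : ℝ), ∀ v ∈ hfin.toFinset, ‖MvPowerSeries.coeff v f‖ < η →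
      ‖MvPowerSeries.coeff v f‖ * ρ ^ wt v ≤ η := by
    rw [eventually_all_finset]
    intro v _
    by_cases hv : ‖MvPowerSeries.coeff v f‖ < η
    · refine nhdsWithin_le_nhds ?_
      have : Tendsto (fun ρ : ℝ => ‖MvPowerSeries.coeff v f‖ * ρ ^ wt v) (𝓝 1)
          (𝓝 (‖MvPowerSeries.coeff v f‖ * 1 ^ wt v)) :=
        (continuous_const.mul (continuous_pow _)).tendsto 1
      filter_upwards [this.eventually (gt_mem_nhds (by simpa using hv))] with ρ h _ using h.le
    · exact Eventually.of_forall fun _ h => absurd h hv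
  filter_upwards [h1, h2, self_mem_nhdsWithin] with ρ h1 h2 hρ v hv
  have hρ : 1 < ρ := hρ
  by_cases hm : v ∈ hfin.toFinset
  · exact h2 v hm hv
  · simp only [Set.Finite.mem_toFinset, Set.mem_ofPred_eq, not_not] at hm
    refine le_trans (mul_le_mul_of_nonneg_left ?_ (norm_nonneg _)) hm.le
    rw [Real.rpow_mul hp0.le, Real.rpow_natCast]
    calc ρ ^ wt v ≤ ρ ^ (B * v.degree) := pow_le_pow_right₀ hρ.le (hB v)
      _ = (ρ ^ B) ^ v.degree := pow_mul _ _ _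
      _ ≤ _ := pow_le_pow_left₀ (by positivity) h1.le _

theorem Overconvergent.eventually_gaussBound (hf : Overconvergent p K f)
    (wt : (Fin n →₀ ℕ) →+ ℕ) {η : ℝ} (hη : 1 < η) :
    ∀ᶠ ρ in 𝓝[>] (1 : ℝ), GaussBound wt ρ η f := by
  filter_upwards [hf.eventually_le wt (zero_lt_one.trans hη)] with ρ h v
  exact h v ((RInt.norm_le_one _).trans_lt hη)

theorem Overconvergent.tendsto (hf : Overconvergent p K f) :
    Tendsto (fun v => ‖MvPowerSeries.coeff v f‖) cofinite (𝓝 0) := by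
  obtain ⟨ε, hε, hf⟩ := hf
  simpa using overconvergent_shrink hε.le hf

theorem Overconvergent.finite_le_norm (hf : Overconvergent p K f) {η : ℝ} (hη : 0 < η) :
    {v | η ≤ ‖MvPowerSeries.coeff v f‖}.Finite := by
  simpa using eventually_cofinite.1 (hf.tendsto.eventually (gt_mem_nhds hη))

end Overconvergent

/-! ### Density of polynomials -/

section Density

variable (p : ℕ) [hp : Fact p.Prime] (K : Type*) [NormedField K] [IsUltrametricDist K] (n : ℕ)

/-- The inclusion of the polynomial ring in `T_n^†`. -/
def T.ofPoly : MvPolynomial (Fin n) (RInt K) →ₐ[RInt K] T p K n :=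
  (MvPolynomial.coeToMvPowerSeries.algHom (RInt K)).codRestrict (T p K n) fun q => by
    simpa using! overconvergent_coe q

variable {p K n}

theorem T.coe_ofPoly (q : MvPolynomial (Fin n) (RInt K)) :
    (T.ofPoly p K n q : MvPowerSeries (Fin n) (RInt K)) = q := by
  simp [T.ofPoly]

theorem T.coe_natCast_pow_mul (k m : ℕ) (h : T p K n) :
    (((m : T p K n) ^ k * h : T p K n) : MvPowerSeries (Fin n) (RInt K)) =
      MvPowerSeries.C ((m : RInt K) ^ k) * (h : MvPowerSeries (Fin n) (RInt K)) := by
  simp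

theorem T.coeff_natCast_pow_mul (k m : ℕ) (h : T p K n) (v : Fin n →₀ ℕ) :
    MvPowerSeries.coeff v (((m : T p K n) ^ k * h : T p K n) : MvPowerSeries (Fin n) (RInt K)) =
      (m : RInt K) ^ k * MvPowerSeries.coeff v h.1 := by
  rw [T.coe_natCast_pow_mul, MvPowerSeries.coeff_C_mul]

variable [NormedAlgebra ℚ_[p] K]

/-- Modulo every power of `p`, elements of `T_n^†` are polynomials. -/
theorem T.exists_ofPoly_add (f : T p K n) (k : ℕ) :
    ∃ (q : MvPolynomial (Fin n) (RInt K)) (h : T p K n),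
      f = T.ofPoly p K n q + (p : T p K n) ^ k * h := by
  classical
  have hpk : ((p : RInt K) ^ k) ≠ 0 := pow_ne_zero _ (RInt.p_ne_zero p)
  have hfin := f.2.finite_le_norm (norm_pos_iff.2 hpk)
  let F := hfin.toFinset
  let q : MvPolynomial (Fin n) (RInt K) :=
    ∑ v ∈ F, MvPolynomial.monomial v (MvPowerSeries.coeff v f.1)
  have hq : ∀ v, q.coeff v = if v ∈ F then MvPowerSeries.coeff v f.1 else 0 := by
    intro v
    simp only [q, MvPolynomial.coeff_sum, MvPolynomial.coeff_monomial]
    simp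
  have hex : ∀ v, ∃ c, MvPowerSeries.coeff v f.1 - q.coeff v = (p : RInt K) ^ k * c := by
    intro v
    rw [hq]
    split_ifs with h
    · exact ⟨0, by simp⟩
    · refine RInt.exists_eq_mul hpk ?_
      simp only [F, Set.Finite.mem_toFinset, Set.mem_ofPred_eq, not_le] at h
      simpa using h.le
  choose c hc using hex
  let h : MvPowerSeries (Fin n) (RInt K) := c
  have hh : f.1 - (T.ofPoly p K n q).1 = MvPowerSeries.C ((p : RInt K) ^ k) * h := by
    ext1 v
    rw [MvPowerSeries.coeff_C_mul, T.coe_ofPoly]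
    exact (by simpa using hc v : _ = (p : RInt K) ^ k * c v)
  have hov : Overconvergent p K h :=
    Overconvergent.of_C_mul hpk (hh ▸ (f - T.ofPoly p K n q).2)
  refine ⟨q, ⟨h, hov⟩, ?_⟩
  apply Subtype.ext
  rw [Subalgebra.coe_add, T.coe_natCast_pow_mul, ← hh]
  ring

/-- `T_n^†` is `p`-adically separated. -/
theorem T.eq_zero_of_forall_pow_dvd {f : T p K n} (h : ∀ k : ℕ, (p : T p K n) ^ k ∣ f) :
    f = 0 := by
  apply Subtype.ext
  ext1 v
  by_contra hv
  have hv' : 0 < ‖MvPowerSeries.coeff v f.1‖ := norm_pos_iff.2 hv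
  obtain ⟨k, hk⟩ := exists_pow_lt_of_lt_one hv' (RInt.norm_p_lt_one (K := K) p)
  obtain ⟨g, hg⟩ := h k
  rw [hg, T.coeff_natCast_pow_mul, RInt.norm_mul, RInt.norm_pow] at hk
  exact absurd hk (not_lt.2 (mul_le_of_le_one_right (by positivity) (RInt.norm_le_one _)))

end Density

/-! ### Division with remainder -/

section Division

open scoped MvPowerSeries.WithPiTopology

variable {K : Type*} [NormedField K] [IsUltrametricDist K] {n : ℕ}

/-- An additive map `E` that is close to the identity in a Gauss norm is surjective: a preimage of
`g` is `∑ N^k g`, where `N = 1 - E`. -/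
theorem GaussBound.exists_map_eq [CompleteSpace (RInt K)] {wt : (Fin n →₀ ℕ) →+ ℕ} {ρ θ C : ℝ}
    (hρ : 1 ≤ ρ) (hθ0 : 0 ≤ θ) (hθ1 : θ < 1)
    (E : MvPowerSeries (Fin n) (RInt K) →+ MvPowerSeries (Fin n) (RInt K)) (hE : Continuous E)
    (h : ∀ C g, GaussBound wt ρ C g → GaussBound wt ρ (θ * C) (g - E g))
    {g : MvPowerSeries (Fin n) (RInt K)} (hg : GaussBound wt ρ C g) :
    ∃ G, GaussBound wt ρ C G ∧ E G = g := by
  have hρ0 : 0 < ρ := zero_lt_one.trans_le hρ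
  have hC := hg.nonneg hρ0.le
  let u : ℕ → MvPowerSeries (Fin n) (RInt K) := fun k => (fun x => x - E x)^[k] g
  have hu : ∀ k, u (k + 1) = u k - E (u k) := fun k =>
    Function.iterate_succ_apply' (fun x => x - E x) k g
  have hb : ∀ k, GaussBound wt ρ (θ ^ k * C) (u k) := by
    intro k
    induction k with
    | zero => simpa [u] using hg
    | succ k ih => rw [hu, pow_succ', mul_assoc]; exact h _ _ ih
  have hsum : ∀ v, Summable fun k => MvPowerSeries.coeff v (u k) := by
    intro v
    refine Summable.of_norm_bounded (g := fun k => θ ^ k * C)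
      ((summable_geometric_of_lt_one hθ0 hθ1).mul_right C) fun k => ?_
    exact (le_mul_of_one_le_right (norm_nonneg _) (one_le_pow₀ hρ)).trans (hb k v)
  let G : MvPowerSeries (Fin n) (RInt K) := fun v => ∑' k, MvPowerSeries.coeff v (u k)
  have hG : HasSum u G :=
    MvPowerSeries.WithPiTopology.hasSum_iff_hasSum_coeff.2 fun v => (hsum v).hasSum
  refine ⟨G, fun v => ?_, ?_⟩
  · have hv : 0 < ρ ^ wt v := by positivity
    rw [← le_div_iff₀ hv]
    have hlim := (MvPowerSeries.WithPiTopology.hasSum_iff_hasSum_coeff.1 hG v).norm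
    refine le_of_tendsto hlim (Eventually.of_forall fun s => ?_)
    refine RInt.norm_sum_le _ _ (by positivity) fun k _ => (le_div_iff₀ hv).2 ((hb k v).trans ?_)
    exact mul_le_of_le_one_left hC (pow_le_one₀ hθ0 hθ1.le)
  · have h1 : HasSum (fun k => E (u k)) (E G) := hG.map E hE
    have h2 : HasSum (fun k => u (k + 1)) (G - g) := by
      simpa [u] using (hasSum_nat_add_iff' 1).2 hG
    have h3 := hG.sub h2
    have h4 : (fun k => u k - u (k + 1)) = fun k => E (u k) := by
      funext k
      rw [hu, sub_sub_cancel]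
    rw [h4, sub_sub_cancel] at h3
    exact h1.unique h3

variable {ι : Type*} (sel : (Fin n →₀ ℕ) → Option ι) (a : ι → (Fin n →₀ ℕ))

open scoped Classical in
/-- If each monomial `ξ^v` is assigned to at most one of the monomials `ξ^{a i}`, by `sel`, this is
the quotient by `ξ^{a i}` of the part of a series assigned to `i`. -/
def quotPart (i : ι) : MvPowerSeries (Fin n) (RInt K) →+ MvPowerSeries (Fin n) (RInt K) where
  toFun g := fun w => if sel (w + a i) = some i then MvPowerSeries.coeff (w + a i) g else 0
  map_zero' := by funext w; simp; rfl
  map_add' f g := by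
    funext w
    change _ = (if _ then _ else _ : RInt K) + (if _ then _ else _ : RInt K)
    split_ifs <;> simp

open scoped Classical in
/-- The part of a series whose monomials are assigned to no `ξ^{a i}`. -/
def remPart : MvPowerSeries (Fin n) (RInt K) →+ MvPowerSeries (Fin n) (RInt K) where
  toFun g := fun v => if sel v = none then MvPowerSeries.coeff v g else 0
  map_zero' := by funext w; simp; rfl
  map_add' f g := by
    funext w
    change _ = (if _ then _ else _ : RInt K) + (if _ then _ else _ : RInt K)
    split_ifs <;> simp

open scoped Classical in
theorem coeff_quotPart (i : ι) (g : MvPowerSeries (Fin n) (RInt K)) (w : Fin n →₀ ℕ) :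
    MvPowerSeries.coeff w (quotPart sel a i g) =
      if sel (w + a i) = some i then MvPowerSeries.coeff (w + a i) g else 0 := rfl

open scoped Classical in
theorem coeff_remPart (g : MvPowerSeries (Fin n) (RInt K)) (v : Fin n →₀ ℕ) :
    MvPowerSeries.coeff v (remPart sel g) = if sel v = none then MvPowerSeries.coeff v g else 0 :=
  rfl

theorem continuous_quotPart (i : ι) : Continuous (quotPart (K := K) sel a i) := by
  refine continuous_pi fun w => ?_
  change Continuous fun g => MvPowerSeries.coeff w (quotPart sel a i g)
  simp only [coeff_quotPart]
  split_ifs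
  · exact MvPowerSeries.WithPiTopology.continuous_coeff _ _
  · exact continuous_const

theorem continuous_remPart : Continuous (remPart (K := K) sel) := by
  refine continuous_pi fun w => ?_
  change Continuous fun g => MvPowerSeries.coeff w (remPart sel g)
  simp only [coeff_remPart]
  split_ifs
  · exact MvPowerSeries.WithPiTopology.continuous_coeff _ _
  · exact continuous_const

theorem sum_monomial_mul_quotPart_add_remPart [Fintype ι]
    (hsel : ∀ v i, sel v = some i → a i ≤ v) (g : MvPowerSeries (Fin n) (RInt K)) :
    ∑ i, quotPart sel a i g * MvPowerSeries.monomial (a i) 1 + remPart sel g = g := by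
  classical
  ext1 v
  have h : ∀ i, MvPowerSeries.coeff v (quotPart sel a i g * MvPowerSeries.monomial (a i) 1) =
      if sel v = some i then MvPowerSeries.coeff v g else 0 := by
    intro i
    rw [MvPowerSeries.coeff_mul_monomial]
    by_cases h : a i ≤ v
    · rw [if_pos h, mul_one, coeff_quotPart, tsub_add_cancel_of_le h]
    · rw [if_neg h, if_neg fun h' => h (hsel _ _ h')]
  rw [map_add, map_sum, Finset.sum_congr rfl fun i _ => h i, coeff_remPart]
  cases hv : sel v with
  | none => simp
  | some i => simp

variable {wt : (Fin n →₀ ℕ) →+ ℕ} {ρ C : ℝ} {g : MvPowerSeries (Fin n) (RInt K)}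

theorem GaussBound.quotPart (hρ : 0 < ρ) (hg : GaussBound wt ρ C g) (i : ι) :
    GaussBound wt ρ (C / ρ ^ wt (a i)) (quotPart sel a i g) := fun w => by
  have hC := hg.nonneg hρ.le
  rw [le_div_iff₀ (by positivity), mul_assoc, ← pow_add, ← map_add, coeff_quotPart]
  split_ifs
  · exact hg _
  · simpa using hC

theorem GaussBound.remPart (hρ : 0 < ρ) (hg : GaussBound wt ρ C g) :
    GaussBound wt ρ C (remPart sel g) := fun w => by
  have hC := hg.nonneg hρ.le
  rw [coeff_remPart]
  split_ifs
  · exact hg _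
  · simpa using hC

/-- Division with respect to one Gauss norm, by series that are dominated by their terms
`ξ^{a i}`. -/
theorem GaussBound.exists_division [CompleteSpace (RInt K)] [Fintype ι]
    {f : ι → MvPowerSeries (Fin n) (RInt K)} {θ : ℝ} (hρ : 1 ≤ ρ) (hθ0 : 0 ≤ θ) (hθ1 : θ < 1)
    (hf : ∀ i, GaussBound wt ρ (θ * ρ ^ wt (a i)) (f i - MvPowerSeries.monomial (a i) 1))
    (hg : GaussBound wt ρ C g) :
    ∃ (q : ι → MvPowerSeries (Fin n) (RInt K)) (r : MvPowerSeries (Fin n) (RInt K)),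
      (∀ i, GaussBound wt ρ (C / ρ ^ wt (a i)) (q i)) ∧ GaussBound wt ρ C r ∧
      g = ∑ i, q i * f i + r ∧ ∀ i v, a i ≤ v → MvPowerSeries.coeff v r = 0 := by
  classical
  have hρ0 : 0 < ρ := zero_lt_one.trans_le hρ
  let sel : (Fin n →₀ ℕ) → Option ι := fun v =>
    if h : ∃ i, a i ≤ v then some h.choose else none
  have hsel : ∀ v i, sel v = some i → a i ≤ v := by
    intro v i h
    simp only [sel] at h
    split_ifs at h with h'
    exact Option.some_injective _ h ▸ h'.choose_spec
  let E : MvPowerSeries (Fin n) (RInt K) →+ MvPowerSeries (Fin n) (RInt K) :=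
    ∑ i, (AddMonoidHom.mulRight (f i)).comp (DaggerAlg.quotPart sel a i) + DaggerAlg.remPart sel
  have hEapp : ∀ x, E x = ∑ i, DaggerAlg.quotPart sel a i x * f i + DaggerAlg.remPart sel x := by
    intro x
    simp [E]
  have hE : Continuous E := by
    have : (E : MvPowerSeries (Fin n) (RInt K) → MvPowerSeries (Fin n) (RInt K)) =
      fun x => ∑ i, DaggerAlg.quotPart sel a i x * f i + DaggerAlg.remPart sel x := funext hEapp
    rw [this]
    exact (continuous_finsetSum _ fun i _ =>
      (continuous_quotPart sel a i).mul continuous_const).add (continuous_remPart sel)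
  obtain ⟨G, hG, hEG⟩ := GaussBound.exists_map_eq hρ hθ0 hθ1 E hE (fun D x hx => by
    have hD := hx.nonneg hρ0.le
    have h1 : x - E x = -∑ i, DaggerAlg.quotPart sel a i x *
        (f i - MvPowerSeries.monomial (a i) 1) := by
      rw [hEapp]
      nth_rewrite 1 [← sum_monomial_mul_quotPart_add_remPart sel a hsel x]
      simp only [mul_sub, Finset.sum_sub_distrib]
      ring
    rw [h1]
    refine (GaussBound.sum hρ0 (mul_nonneg hθ0 hD) _ fun i _ => ?_).neg
    refine ((hx.quotPart sel a hρ0 i).mul hρ0 (hf i)).mono (le_of_eq ?_)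
    field_simp) hg
  refine ⟨fun i => DaggerAlg.quotPart sel a i G, DaggerAlg.remPart sel G,
    fun i => hG.quotPart sel a hρ0 i, hG.remPart sel hρ0, by rw [← hEapp, hEG], fun i v hi => ?_⟩
  have hex : ∃ i, a i ≤ v := ⟨i, hi⟩
  rw [coeff_remPart, if_neg]
  simp only [sel, dif_pos hex]
  exact Option.some_ne_none _

end Division

section DaggerDivision

variable {p : ℕ} [hp : Fact p.Prime] {K : Type*} [NormedField K] [IsUltrametricDist K] {n : ℕ}

theorem Overconvergent.eventually_norm_lt {f : MvPowerSeries (Fin n) (RInt K)}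
    (hf : Overconvergent p K f) :
    ∀ᶠ η in 𝓝[<] (1 : ℝ), ∀ v, ‖MvPowerSeries.coeff v f‖ < 1 → ‖MvPowerSeries.coeff v f‖ < η := by
  have hfin := hf.finite_le_norm (η := 1 / 2) (by norm_num)
  have h1 : ∀ᶠ η in 𝓝[<] (1 : ℝ), ∀ v ∈ hfin.toFinset,
      ‖MvPowerSeries.coeff v f‖ < 1 → ‖MvPowerSeries.coeff v f‖ < η := by
    rw [eventually_all_finset]
    intro v _
    by_cases hv : ‖MvPowerSeries.coeff v f‖ < 1
    · filter_upwards [nhdsWithin_le_nhds (lt_mem_nhds hv)] with η h _ using h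
    · exact Eventually.of_forall fun _ h => absurd h hv
  filter_upwards [h1, nhdsWithin_le_nhds (lt_mem_nhds (by norm_num : (1 / 2 : ℝ) < 1))]
    with η h1 h2 v hv
  by_cases hm : v ∈ hfin.toFinset
  · exact h1 v hm hv
  · simp only [Set.Finite.mem_toFinset, Set.mem_ofPred_eq, not_le] at hm
    exact hm.trans h2

/-- Division with remainder in `T_n^†`: if, for a weight of the variables, `ξ^{a i}` is the term of
greatest weight among the terms of `f i` with unit coefficients, then division by the `f i` leaves a
remainder without monomials divisible by some `ξ^{a i}`. -/
theorem T.exists_division [CompleteSpace (RInt K)] {ι : Type*} [Fintype ι]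
    {wt : (Fin n →₀ ℕ) →+ ℕ} (hwt : ∀ v, v.degree ≤ wt v) (f : ι → T p K n)
    (a : ι → (Fin n →₀ ℕ)) (h1 : ∀ i, MvPowerSeries.coeff (a i) (f i).1 = 1)
    (h2 : ∀ i v, v ≠ a i → ‖MvPowerSeries.coeff v (f i).1‖ < 1 ∨ wt v < wt (a i))
    (g : T p K n) :
    ∃ (q : ι → T p K n) (r : T p K n), g = ∑ i, q i * f i + r ∧
      ∀ i v, a i ≤ v → MvPowerSeries.coeff v r.1 = 0 := by
  classical
  obtain ⟨η, hη, hη0, hη1⟩ : ∃ η : ℝ, (∀ i, ∀ v, ‖MvPowerSeries.coeff v (f i).1‖ < 1 →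
      ‖MvPowerSeries.coeff v (f i).1‖ < η) ∧ 0 < η ∧ η < 1 :=
    ((eventually_all.2 fun i => (f i).2.eventually_norm_lt).and
      (Eventually.and (nhdsWithin_le_nhds (lt_mem_nhds zero_lt_one)) self_mem_nhdsWithin)).exists
  obtain ⟨ρ, hρf, hρg, hρ⟩ : ∃ ρ : ℝ, (∀ i, ∀ v, ‖MvPowerSeries.coeff v (f i).1‖ < η →
      ‖MvPowerSeries.coeff v (f i).1‖ * ρ ^ wt v ≤ η) ∧ GaussBound wt ρ 2 g.1 ∧ 1 < ρ :=
    ((eventually_all.2 fun i => (f i).2.eventually_le wt hη0).and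
      ((g.2.eventually_gaussBound wt one_lt_two).and self_mem_nhdsWithin)).exists
  have hρ0 : 0 < ρ := zero_lt_one.trans hρ
  have hθ0 : 0 ≤ max η ρ⁻¹ := le_max_of_le_left hη0.le
  have hθ1 : max η ρ⁻¹ < 1 := max_lt hη1 (inv_lt_one_of_one_lt₀ hρ)
  have hf : ∀ i, GaussBound wt ρ (max η ρ⁻¹ * ρ ^ wt (a i))
      ((f i).1 - MvPowerSeries.monomial (a i) 1) := by
    intro i v
    rw [map_sub, MvPowerSeries.coeff_monomial]
    by_cases hv : v = a i
    · rw [if_pos hv, hv, h1, sub_self, norm_zero, zero_mul]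
      positivity
    · rw [if_neg hv, sub_zero]
      rcases h2 i v hv with h | h
      · exact (hρf i v (hη i v h)).trans
          ((le_max_left _ _).trans (le_mul_of_one_le_right hθ0 (one_le_pow₀ hρ.le)))
      · calc _ ≤ 1 * ρ ^ wt v := by gcongr; exact RInt.norm_le_one _
          _ ≤ ρ⁻¹ * ρ ^ wt (a i) := by
            rw [one_mul, inv_mul_eq_div, le_div_iff₀ hρ0, ← pow_succ]
            exact pow_le_pow_right₀ hρ.le h
          _ ≤ _ := by gcongr; exact le_max_right _ _
  obtain ⟨q, r, hq, hr, hgq, hrz⟩ := GaussBound.exists_division a hρ.le hθ0 hθ1 hf hρg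
  refine ⟨fun i => ⟨q i, (hq i).overconvergent hwt hρ⟩, ⟨r, hr.overconvergent hwt hρ⟩, ?_, hrz⟩
  apply Subtype.ext
  simpa using hgq

end DaggerDivision

/-! ### Leading exponents -/

section Lead

/-- The weights `∑ v_i B^{n-i}`, which for large `B` order any finite set of exponents
lexicographically. -/
def lexWeight (n B : ℕ) : (Fin n →₀ ℕ) →+ ℕ where
  toFun v := ∑ i, v i * B ^ (n - i)
  map_zero' := by simp
  map_add' u v := by simp [add_mul, Finset.sum_add_distrib]

variable {n : ℕ}

theorem lexWeight_apply (B : ℕ) (v : Fin n →₀ ℕ) :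
    lexWeight n B v = ∑ i, v i * B ^ (n - i) := rfl

theorem degree_le_lexWeight {B : ℕ} (hB : 1 ≤ B) (v : Fin n →₀ ℕ) :
    v.degree ≤ lexWeight n B v := by
  rw [Finsupp.degree_eq_sum, lexWeight_apply]
  exact Finset.sum_le_sum fun i _ => Nat.le_mul_of_pos_right _ (pow_pos hB _)

theorem eventually_lexWeight_lt {u v : Fin n →₀ ℕ} (h : toLex u < toLex v) :
    ∀ᶠ B in atTop, lexWeight n B u < lexWeight n B v := by
  obtain ⟨j, hj, hlt⟩ := Finsupp.Lex.lt_iff.1 h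
  simp only [ofLex_toLex] at hj hlt
  filter_upwards [eventually_gt_atTop u.degree] with B hB
  have hB1 : 1 ≤ B := by omega
  simp only [lexWeight_apply]
  have hsplit : ∀ w : Fin n →₀ ℕ, ∑ i, w i * B ^ (n - (i : ℕ)) =
      ∑ i ∈ Finset.univ.filter (· < j), w i * B ^ (n - (i : ℕ)) + (w j * B ^ (n - (j : ℕ)) +
        ∑ i ∈ Finset.univ.filter (j < ·), w i * B ^ (n - (i : ℕ))) := by
    intro w
    rw [← Finset.sum_filter_add_sum_filter_not Finset.univ (· < j)]
    congr 1
    have : Finset.univ.filter (fun i => ¬ i < j) = insert j (Finset.univ.filter (j < ·)) := by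
      ext i
      simp [le_iff_eq_or_lt, eq_comm]
    rw [this, Finset.sum_insert (by simp)]
  have hlow : ∑ i ∈ Finset.univ.filter (j < ·), u i * B ^ (n - (i : ℕ)) < B ^ (n - (j : ℕ)) := by
    calc _ ≤ ∑ i ∈ Finset.univ.filter (j < ·), u i * B ^ (n - (j : ℕ) - 1) := by
          refine Finset.sum_le_sum fun i hi => Nat.mul_le_mul_left _ (Nat.pow_le_pow_right hB1 ?_)
          have : j < i := (Finset.mem_filter.1 hi).2
          have : (j : ℕ) < i := this
          omega
      _ ≤ u.degree * B ^ (n - (j : ℕ) - 1) := by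
          rw [← Finset.sum_mul, Finsupp.degree_eq_sum]
          exact Nat.mul_le_mul_right _ (Finset.sum_le_sum_of_subset (Finset.filter_subset _ _))
      _ < B * B ^ (n - (j : ℕ) - 1) := Nat.mul_lt_mul_of_pos_right hB (pow_pos hB1 _)
      _ = B ^ (n - (j : ℕ)) := by
          rw [← pow_succ']
          congr 1
          omega
  rw [hsplit u, hsplit v]
  have h1 : ∑ i ∈ Finset.univ.filter (· < j), u i * B ^ (n - (i : ℕ)) =
      ∑ i ∈ Finset.univ.filter (· < j), v i * B ^ (n - (i : ℕ)) :=
    Finset.sum_congr rfl fun i hi => by rw [hj i (Finset.mem_filter.1 hi).2]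
  have h2 : u j * B ^ (n - (j : ℕ)) + B ^ (n - (j : ℕ)) ≤ v j * B ^ (n - (j : ℕ)) := by
    rw [← Nat.succ_mul]
    exact Nat.mul_le_mul_right _ hlt
  omega

variable {K : Type*} [NormedField K] [IsUltrametricDist K]

/-- `a` is the lexicographically greatest exponent at which `f` has a unit coefficient, that is, the
leading exponent of the reduction of `f` to the residue field. -/
def IsLead (f : MvPowerSeries (Fin n) (RInt K)) (a : Fin n →₀ ℕ) : Prop :=
  ‖MvPowerSeries.coeff a f‖ = 1 ∧ ∀ v, v ≠ a → ‖MvPowerSeries.coeff v f‖ < 1 ∨ toLex v < toLex a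

theorem Overconvergent.exists_isLead {p : ℕ} [Fact p.Prime] {f : MvPowerSeries (Fin n) (RInt K)}
    (hf : Overconvergent p K f) {v : Fin n →₀ ℕ} (hv : ‖MvPowerSeries.coeff v f‖ = 1) :
    ∃ a, IsLead f a := by
  have hfin := hf.finite_le_norm one_pos
  obtain ⟨a, ha, hmax⟩ := hfin.toFinset.exists_max_image toLex ⟨v, hfin.mem_toFinset.2 hv.ge⟩
  simp only [Set.Finite.mem_toFinset, Set.mem_ofPred_eq] at ha hmax
  refine ⟨a, le_antisymm (RInt.norm_le_one _) ha, fun w hw => ?_⟩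
  by_cases h : ‖MvPowerSeries.coeff w f‖ < 1
  · exact Or.inl h
  · exact Or.inr (lt_of_le_of_ne (hmax w (not_lt.1 h)) fun h' => hw (toLex.injective h'))

theorem IsLead.eventually {p : ℕ} [Fact p.Prime] {f : MvPowerSeries (Fin n) (RInt K)}
    (hf : Overconvergent p K f) {a : Fin n →₀ ℕ} (ha : IsLead f a) :
    ∀ᶠ B in atTop, ∀ v, v ≠ a →
      ‖MvPowerSeries.coeff v f‖ < 1 ∨ lexWeight n B v < lexWeight n B a := by
  have hfin := hf.finite_le_norm one_pos
  have h : ∀ᶠ B in atTop, ∀ v ∈ hfin.toFinset, v ≠ a → lexWeight n B v < lexWeight n B a := by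
    rw [eventually_all_finset]
    intro v hv
    simp only [Set.Finite.mem_toFinset, Set.mem_ofPred_eq] at hv
    by_cases hva : v = a
    · exact Eventually.of_forall fun _ h => absurd hva h
    · filter_upwards [eventually_lexWeight_lt ((ha.2 v hva).resolve_left (not_lt.2 hv))]
        with B h _ using h
  filter_upwards [h] with B h v hv
  by_cases hv1 : ‖MvPowerSeries.coeff v f‖ < 1
  · exact Or.inl hv1
  · exact Or.inr (h v (by simpa using hv1) hv)

end Lead

/-! ### Noetherianity and separatedness -/

section Noetherian

variable {p : ℕ} [hp : Fact p.Prime] {K : Type*} [NormedField K] [IsUltrametricDist K] {n : ℕ}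

theorem T.coeff_smul (c : RInt K) (f : T p K n) (v : Fin n →₀ ℕ) :
    MvPowerSeries.coeff v (c • f : T p K n).1 = c * MvPowerSeries.coeff v f.1 := rfl

/-- A nonzero element of `T_n^†` is a constant multiple of one with a unit coefficient, because its
coefficients tend to zero. -/
theorem T.exists_eq_smul {f : T p K n} (hf : f ≠ 0) :
    ∃ (c : RInt K) (g : T p K n) (v : Fin n →₀ ℕ), c ≠ 0 ∧ f = c • g ∧
      MvPowerSeries.coeff v g.1 = 1 := by
  obtain ⟨v₀, hv₀⟩ : ∃ v, MvPowerSeries.coeff v f.1 ≠ 0 := by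
    by_contra! h
    exact hf (Subtype.ext (MvPowerSeries.ext h))
  have hfin := f.2.finite_le_norm (norm_pos_iff.2 hv₀)
  obtain ⟨v, hv, hmax⟩ := hfin.toFinset.exists_max_image
    (fun v => ‖MvPowerSeries.coeff v f.1‖) ⟨v₀, hfin.mem_toFinset.2 (le_refl ‖MvPowerSeries.coeff v₀ f.1‖)⟩
  have hv' := hfin.mem_toFinset.1 hv
  have hc : MvPowerSeries.coeff v f.1 ≠ 0 :=
    norm_pos_iff.1 ((norm_pos_iff.2 hv₀).trans_le hv')
  have hle : ∀ w, ‖MvPowerSeries.coeff w f.1‖ ≤ ‖MvPowerSeries.coeff v f.1‖ := by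
    intro w
    by_cases hw : w ∈ hfin.toFinset
    · exact hmax w hw
    · exact (lt_of_not_ge fun h => hw (hfin.mem_toFinset.2 h)).le.trans hv'
  choose d hd using fun w => RInt.exists_eq_mul hc (hle w)
  let g : MvPowerSeries (Fin n) (RInt K) := d
  have hfg : f.1 = MvPowerSeries.C (MvPowerSeries.coeff v f.1) * g := by
    ext1 w
    rw [MvPowerSeries.coeff_C_mul]
    exact hd w
  have hov : Overconvergent p K g :=
    Overconvergent.of_C_mul hc (hfg ▸ f.2)
  refine ⟨_, ⟨g, hov⟩, v, hc, ?_, ?_⟩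
  · apply Subtype.ext
    rw [Subalgebra.coe_smul, MvPowerSeries.smul_eq_C_mul]
    exact hfg
  · exact mul_left_cancel₀ hc (by rw [mul_one]; exact (hd v).symm)

variable [NormedAlgebra ℚ_[p] K]

/-- An ideal that contains `p` is generated by the polynomials in it. -/
theorem T.fg_of_natCast_mem [IsNoetherianRing (RInt K)] {I : Ideal (T p K n)}
    (hI : (p : T p K n) ∈ I) : I.FG := by
  suffices h : I = (I.comap (T.ofPoly p K n)).map (T.ofPoly p K n) by
    rw [h]
    exact Ideal.FG.map (IsNoetherian.noetherian (I.comap (T.ofPoly p K n))) _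
  refine le_antisymm (fun f hf => ?_) Ideal.map_comap_le
  obtain ⟨q, h, hfq⟩ := T.exists_ofPoly_add f 1
  rw [pow_one] at hfq
  have hq : T.ofPoly p K n q ∈ I := by
    have : T.ofPoly p K n q = f - p * h := by rw [hfq, add_sub_cancel_right]
    rw [this]
    exact I.sub_mem hf (I.mul_mem_right _ hI)
  rw [hfq]
  refine Ideal.add_mem _ (Ideal.mem_map_of_mem _ hq) (Ideal.mul_mem_right _ _ ?_)
  have := Ideal.mem_map_of_mem (T.ofPoly p K n)
    (show (p : MvPolynomial (Fin n) (RInt K)) ∈ I.comap (T.ofPoly p K n) by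
      rw [Ideal.mem_comap, map_natCast]; exact hI)
  rwa [map_natCast] at this

/-- A prime ideal that does not contain `p` is generated by elements whose leading exponents are the
minimal ones. The remainder of the division by these elements vanishes: otherwise it is a nonzero
constant times an element with a leading exponent, which is in the ideal because the nonzero
constants divide powers of `p`, and whose leading exponent is one that the division excludes. -/
theorem T.fg_of_natCast_notMem [CompleteSpace (RInt K)] {I : Ideal (T p K n)} (hI : I.IsPrime)
    (hpI : (p : T p K n) ∉ I) : I.FG := by
  classical
  have hconst : ∀ (c : RInt K) (f : T p K n), c ≠ 0 → c • f ∈ I → f ∈ I := by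
    intro c f hc hcf
    rw [Algebra.smul_def] at hcf
    refine (hI.mem_or_mem hcf).resolve_left fun hcI => hpI ?_
    obtain ⟨k, hk⟩ := exists_pow_lt_of_lt_one (norm_pos_iff.2 hc) (RInt.norm_p_lt_one (K := K) p)
    rw [← RInt.norm_pow] at hk
    obtain ⟨d, hd⟩ := RInt.exists_eq_mul hc hk.le
    refine hI.mem_of_pow_mem k ?_
    have : (p : T p K n) ^ k = algebraMap (RInt K) (T p K n) c * algebraMap _ _ d := by
      rw [← map_mul, ← hd, map_pow, map_natCast]
    rw [this]
    exact I.mul_mem_right _ hcI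
  let L : Set (Fin n →₀ ℕ) :=
    {a | ∃ f ∈ I, MvPowerSeries.coeff a f.1 = 1 ∧ IsLead f.1 a}
  have hS : {a | Minimal (· ∈ L) a}.Finite :=
    WellQuasiOrderedLE.finite_of_isAntichain (setOfPred_minimal_antichain _)
  let _ : Fintype {a | Minimal (· ∈ L) a} := hS.fintype
  choose f hfI hf1 hflead using fun s : {a | Minimal (· ∈ L) a} => s.2.prop
  obtain ⟨B, hB, hB1⟩ := ((eventually_all.2 fun s => (hflead s).eventually (f s).2).and
    (eventually_ge_atTop 1)).exists
  refine ⟨Finset.univ.image f, le_antisymm (Ideal.span_le.2 ?_) fun g hg => ?_⟩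
  · intro x hx
    simp only [Finset.coe_image, Finset.coe_univ, Set.image_univ, Set.mem_range] at hx
    obtain ⟨s, rfl⟩ := hx
    exact hfI s
  · obtain ⟨q, r, hgq, hr⟩ := T.exists_division (degree_le_lexWeight hB1) f
      (fun s => s.1) hf1 hB g
    have hsum : ∑ s, q s * f s ∈ I := I.sum_mem fun s _ => I.mul_mem_left _ (hfI s)
    have hrI : r ∈ I := by
      have : r = g - ∑ s, q s * f s := by rw [hgq, add_sub_cancel_left]
      rw [this]
      exact I.sub_mem hg hsum
    have hr0 : r = 0 := by
      by_contra hr0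
      obtain ⟨c, r', v, hc, hrr', hv⟩ := T.exists_eq_smul hr0
      have hr'I : r' ∈ I := hconst c r' hc (hrr' ▸ hrI)
      obtain ⟨a, ha⟩ := r'.2.exists_isLead (v := v) (by rw [hv, norm_one])
      -- normalise the leading coefficient
      have hane : MvPowerSeries.coeff a r'.1 ≠ 0 := by
        rw [← norm_pos_iff, ha.1]
        exact one_pos
      obtain ⟨d, hd⟩ := RInt.exists_eq_mul (b := 1) hane (by rw [ha.1, norm_one])
      have hdn : ‖d‖ = 1 := by
        have := congrArg norm hd
        rwa [RInt.norm_mul, ha.1, one_mul, norm_one, eq_comm] at this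
      have haL : a ∈ L := by
        have hcoef : ∀ w, ‖MvPowerSeries.coeff w (d • r' : T p K n).1‖ =
            ‖MvPowerSeries.coeff w r'.1‖ := fun w => by
          rw [T.coeff_smul, RInt.norm_mul, hdn, one_mul]
        refine ⟨d • r', ?_, ?_, ?_, fun w hw => ?_⟩
        · rw [Algebra.smul_def]
          exact I.mul_mem_left _ hr'I
        · rw [T.coeff_smul, mul_comm, ← hd]
        · rw [hcoef, ha.1]
        · rw [hcoef]
          exact ha.2 w hw
      obtain ⟨s, hsa, hs⟩ := exists_minimal_le_of_wellFoundedLT (· ∈ L) a haL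
      have h0 := hr ⟨s, hs⟩ a hsa
      rw [hrr', T.coeff_smul] at h0
      exact mul_ne_zero hc hane h0
    rw [hgq, hr0, add_zero]
    exact Ideal.sum_mem _ fun s _ => Ideal.mul_mem_left _ _
      (Ideal.subset_span (by simp))

theorem T.isUnit_natCast_mul_add_one [CompleteSpace (RInt K)] (f : T p K n) :
    IsUnit ((p : T p K n) * f + 1) := by
  classical
  have hcoef : ∀ v, MvPowerSeries.coeff v ((p : T p K n) * f + 1).1 =
      p * MvPowerSeries.coeff v f.1 + MvPowerSeries.coeff v 1 := by
    intro v
    have := T.coeff_natCast_pow_mul 1 p f v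
    rw [pow_one, pow_one] at this
    rw [Subalgebra.coe_add, map_add, this]
    rfl
  have hlt : ∀ v, ‖(p : RInt K) * MvPowerSeries.coeff v f.1‖ < 1 := fun v => by
    rw [RInt.norm_mul]
    exact (mul_le_of_le_one_right (norm_nonneg _) (RInt.norm_le_one _)).trans_lt
      (RInt.norm_p_lt_one p)
  have h0 : 1 ≤ ‖MvPowerSeries.coeff 0 ((p : T p K n) * f + 1).1‖ := by
    by_contra! h
    have h2 := IsUltrametricDist.norm_add_le_max
      ((MvPowerSeries.coeff 0 ((p : T p K n) * f + 1).1 : RInt K) : K)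
      (-((p : RInt K) * MvPowerSeries.coeff 0 f.1 : RInt K) : K)
    have h3 := h2.trans_lt (max_lt h (by rw [norm_neg]; exact hlt 0))
    rw [← sub_eq_add_neg, ← AddSubgroupClass.coe_sub, hcoef, add_sub_cancel_left,
      MvPowerSeries.coeff_zero_one] at h3
    simp at h3
  have hne : MvPowerSeries.coeff 0 ((p : T p K n) * f + 1).1 ≠ 0 :=
    norm_pos_iff.1 (one_pos.trans_le h0)
  obtain ⟨d, hd⟩ := RInt.exists_eq_mul (b := 1) hne (by rw [norm_one]; exact h0)
  obtain ⟨q, r, hq, hr⟩ := T.exists_division (ι := Unit) (degree_le_lexWeight le_rfl)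
    (fun _ => d • ((p : T p K n) * f + 1)) (fun _ => 0)
    (fun _ => by rw [T.coeff_smul, mul_comm, ← hd])
    (fun _ v hv => Or.inl (by
      rw [T.coeff_smul, hcoef, MvPowerSeries.coeff_one, if_neg hv, add_zero, RInt.norm_mul]
      exact (mul_le_of_le_one_left (norm_nonneg _) (RInt.norm_le_one _)).trans_lt (hlt v))) 1
  have hr0 : r = 0 := Subtype.ext (MvPowerSeries.ext fun v => hr () v zero_le)
  rw [hr0, add_zero, Fintype.sum_unique] at hq
  refine IsUnit.of_mul_eq_one (d • q default) ?_
  refine Eq.trans ?_ hq.symm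
  rw [mul_smul_comm, mul_smul_comm, mul_comm]

variable [FiniteDimensional ℚ_[p] K]

variable (p K n) in
/-- By Cohen's theorem it is enough to consider prime ideals. -/
theorem T.isNoetherianRing : IsNoetherianRing (T p K n) := by
  have := RInt.isNoetherianRing (K := K) p
  have : CompleteSpace K := FiniteDimensional.complete ℚ_[p] K
  have := RInt.completeSpace (K := K)
  refine IsNoetherianRing.of_prime fun I hI => ?_
  by_cases hpI : (p : T p K n) ∈ I
  · exact T.fg_of_natCast_mem hpI
  · exact T.fg_of_natCast_notMem hI hpI

variable {A : Type*} [CommRing A] [Algebra (RInt K) A]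

theorem Presentation.isNoetherianRing (P : Presentation p K A) : IsNoetherianRing A :=
  have := T.isNoetherianRing p K P.n
  isNoetherianRing_of_surjective _ _ P.toHom.toRingHom P.surjective

theorem Presentation.natCast_mem_jacobson (P : Presentation p K A) :
    (p : A) ∈ (⊥ : Ideal A).jacobson := by
  have : CompleteSpace K := FiniteDimensional.complete ℚ_[p] K
  have := RInt.completeSpace (K := K)
  refine Ideal.mem_jacobson_bot.2 fun y => ?_
  obtain ⟨f, rfl⟩ := P.surjective y
  simpa using (T.isUnit_natCast_mul_add_one f).map P.toHom

/-- Finite modules over a w.c.f.g. algebra are `p`-adically separated, by Krull's intersection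
theorem. -/
theorem Presentation.eq_zero_of_forall_pow_smul (P : Presentation p K A) {M : Type*}
    [AddCommGroup M] [Module A M] [Module.Finite A M] {x : M}
    (h : ∀ k : ℕ, ∃ y, x = p ^ k • y) : x = 0 := by
  have := P.isNoetherianRing
  have hle : Ideal.span {(p : A)} ≤ (⊥ : Ideal A).jacobson :=
    (Ideal.span_singleton_le_iff_mem _).2 P.natCast_mem_jacobson
  have hK := Ideal.iInf_pow_smul_eq_bot_of_le_jacobson (M := M) _ hle
  rw [← Submodule.mem_bot A, ← hK, Submodule.mem_iInf]
  intro k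
  obtain ⟨y, rfl⟩ := h k
  rw [← Nat.cast_smul_eq_nsmul A, Nat.cast_pow]
  exact Submodule.smul_mem_smul (Ideal.pow_mem_pow (Ideal.mem_span_singleton_self _) k) trivial

/-- An additive map from `T_n^†` to a finite module over a w.c.f.g. algebra is determined by its
values on polynomials. -/
theorem Presentation.addMonoidHom_eq_zero (P : Presentation p K A) {M : Type*}
    [AddCommGroup M] [Module A M] [Module.Finite A M] {L : T p K n →+ M}
    (h : ∀ q, L (T.ofPoly p K n q) = 0) : L = 0 := by
  ext f
  refine P.eq_zero_of_forall_pow_smul fun k => ?_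
  obtain ⟨q, g, rfl⟩ := T.exists_ofPoly_add f k
  refine ⟨L g, ?_⟩
  rw [map_add, h, zero_add, ← Nat.cast_pow, ← nsmul_eq_mul, map_nsmul]

end Noetherian

/-! ### Evaluation of overconvergent series -/

section Eval

variable {p : ℕ} [hp : Fact p.Prime] {K : Type*} [NormedField K] [IsUltrametricDist K] {n k : ℕ}

variable (p K) in
/-- The variable `ξ_i` as an element of `T_n^†`. -/
def T.X (i : Fin n) : T p K n := T.ofPoly p K n (MvPolynomial.X i)

theorem T.coe_X (i : Fin n) : (T.X p K i : MvPowerSeries (Fin n) (RInt K)) = MvPowerSeries.X i := by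
  rw [T.X, T.coe_ofPoly, MvPolynomial.coe_X]

theorem T.rename_X (e : Fin n ↪ Fin k) (i : Fin n) :
    T.rename p K e (T.X p K i) = T.X p K (e i) := by
  apply Subtype.ext
  rw [T.coe_X]
  change MvPowerSeries.rename e (T.X p K i).1 = _
  rw [T.coe_X, MvPowerSeries.rename_X]

/-- The monomial `g^v` in elements `g_i` of `T_n^†`. -/
def monomialValue (g : Fin k → T p K n) (v : Fin k →₀ ℕ) : T p K n := ∏ i, g i ^ v i

/-- The power series `∑ c_v g^v`, for `f = ∑ c_v ξ^v`, with the coefficients computed by convergent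
sums in `R`. -/
def evalSeries (g : Fin k → T p K n) (f : T p K k) : MvPowerSeries (Fin n) (RInt K) :=
  fun w => ∑' v, MvPowerSeries.coeff v f.1 * MvPowerSeries.coeff w (monomialValue g v).1

theorem GaussBound.monomialValue {wt : (Fin n →₀ ℕ) →+ ℕ} {ρ σ : ℝ} (hρ : 0 < ρ)
    {g : Fin k → T p K n} (hg : ∀ i, GaussBound wt ρ σ (g i).1) (v : Fin k →₀ ℕ) :
    GaussBound wt ρ (σ ^ v.degree) (monomialValue g v).1 := by
  have h : ∀ s : Finset (Fin k), GaussBound wt ρ (σ ^ ∑ i ∈ s, v i) (∏ i ∈ s, g i ^ v i).1 := by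
    classical
    intro s
    induction s using Finset.induction_on with
    | empty => simpa using gaussBound_one
    | insert i s hi ih =>
      rw [Finset.prod_insert hi, Finset.sum_insert hi, pow_add]
      exact ((hg i).pow hρ (v i)).mul hρ ih
  rw [Finsupp.degree_eq_sum]
  exact h Finset.univ

variable [CompleteSpace (RInt K)]

theorem summable_evalSeries (g : Fin k → T p K n) (f : T p K k) (w : Fin n →₀ ℕ) :
    Summable fun v =>
      MvPowerSeries.coeff v f.1 * MvPowerSeries.coeff w (monomialValue g v).1 := by
  refine NonarchimedeanAddGroup.summable_of_tendsto_cofinite_zero ?_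
  rw [tendsto_zero_iff_norm_tendsto_zero]
  refine squeeze_zero (fun v => norm_nonneg _) (fun v => ?_) f.2.tendsto
  rw [RInt.norm_mul]
  exact mul_le_of_le_one_right (norm_nonneg _) (RInt.norm_le_one _)

theorem overconvergent_evalSeries (g : Fin k → T p K n) (f : T p K k) :
    Overconvergent p K (evalSeries g f) := by
  obtain ⟨σ, hf, hσ⟩ := ((f.2.eventually_gaussBound Finsupp.degree one_lt_two).and
    self_mem_nhdsWithin).exists
  obtain ⟨ρ, hg, hρ⟩ : ∃ ρ : ℝ, (∀ i, GaussBound Finsupp.degree ρ σ (g i).1) ∧ 1 < ρ :=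
    ((eventually_all.2 fun i => (g i).2.eventually_gaussBound Finsupp.degree hσ).and
      self_mem_nhdsWithin).exists
  have hρ0 : 0 < ρ := zero_lt_one.trans hρ
  refine GaussBound.overconvergent (wt := Finsupp.degree) (fun v => le_rfl) hρ (C := 2) fun w => ?_
  have hw : 0 < ρ ^ Finsupp.degree w := by positivity
  rw [← le_div_iff₀ hw]
  refine le_of_tendsto (summable_evalSeries g f w).hasSum.norm (Eventually.of_forall fun s => ?_)
  refine RInt.norm_sum_le _ _ (by positivity) fun v _ => (le_div_iff₀ hw).2 ?_
  rw [RInt.norm_mul, mul_assoc]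
  exact (mul_le_mul_of_nonneg_left (GaussBound.monomialValue hρ0 hg v w) (norm_nonneg _)).trans
    (hf v)

/-- Evaluation at `g` as a linear map. -/
def evalLinear (g : Fin k → T p K n) : T p K k →ₗ[RInt K] T p K n where
  toFun f := ⟨evalSeries g f, overconvergent_evalSeries g f⟩
  map_add' f₁ f₂ := by
    apply Subtype.ext
    funext w
    change ∑' v, (_ : RInt K) = (∑' v, (_ : RInt K)) + ∑' v, (_ : RInt K)
    rw [← (summable_evalSeries g f₁ w).tsum_add (summable_evalSeries g f₂ w)]
    refine tsum_congr fun v => ?_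
    rw [Subalgebra.coe_add, map_add, add_mul]
  map_smul' c f := by
    apply Subtype.ext
    funext w
    change ∑' v, (_ : RInt K) = c * ∑' v, (_ : RInt K)
    rw [← (summable_evalSeries g f w).tsum_mul_left]
    refine tsum_congr fun v => ?_
    rw [T.coeff_smul, mul_assoc]

theorem evalLinear_ofPoly (g : Fin k → T p K n) (q : MvPolynomial (Fin k) (RInt K)) :
    evalLinear g (T.ofPoly p K k q) = MvPolynomial.aeval g q := by
  classical
  suffices h : evalLinear g ∘ₗ (T.ofPoly p K k).toLinearMap =
      (MvPolynomial.aeval g).toLinearMap from LinearMap.congr_fun h q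
  refine MvPolynomial.linearMap_ext fun v => LinearMap.ext fun c => ?_
  apply Subtype.ext
  ext1 w
  change ∑' u, MvPowerSeries.coeff u (T.ofPoly p K k (MvPolynomial.monomial v c)).1 * _ =
    MvPowerSeries.coeff w (MvPolynomial.aeval g (MvPolynomial.monomial v c)).1
  rw [MvPolynomial.aeval_monomial, ← Algebra.smul_def, T.coeff_smul, tsum_eq_single v]
  · rw [T.coe_ofPoly, MvPolynomial.coeff_coe, MvPolynomial.coeff_monomial, if_pos rfl,
      monomialValue, Finsupp.prod_fintype _ _ (fun i => pow_zero _)]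
  · intro u hu
    rw [T.coe_ofPoly, MvPolynomial.coeff_coe, MvPolynomial.coeff_monomial, if_neg hu.symm, zero_mul]

variable [NormedAlgebra ℚ_[p] K]

/-- Evaluation is multiplicative on polynomials, hence modulo every power of `p`. -/
theorem evalLinear_mul (g : Fin k → T p K n) (f₁ f₂ : T p K k) :
    evalLinear g (f₁ * f₂) = evalLinear g f₁ * evalLinear g f₂ := by
  rw [← sub_eq_zero]
  refine T.eq_zero_of_forall_pow_dvd fun j => ?_
  obtain ⟨q₁, h₁, rfl⟩ := T.exists_ofPoly_add f₁ j
  obtain ⟨q₂, h₂, rfl⟩ := T.exists_ofPoly_add f₂ j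
  have hp : ∀ h, evalLinear g ((p : T p K k) ^ j * h) = (p : T p K n) ^ j * evalLinear g h := by
    intro h
    rw [← Nat.cast_pow, ← nsmul_eq_mul, map_nsmul, nsmul_eq_mul, Nat.cast_pow]
  have hprod : (T.ofPoly p K k q₁ + (p : T p K k) ^ j * h₁) *
      (T.ofPoly p K k q₂ + (p : T p K k) ^ j * h₂) = T.ofPoly p K k (q₁ * q₂) + (p : T p K k) ^ j *
        (h₁ * (T.ofPoly p K k q₂ + (p : T p K k) ^ j * h₂) + T.ofPoly p K k q₁ * h₂) := by
    rw [map_mul]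
    ring
  refine ⟨evalLinear g (h₁ * (T.ofPoly p K k q₂ + (p : T p K k) ^ j * h₂) +
      T.ofPoly p K k q₁ * h₂) - (MvPolynomial.aeval g q₁ * evalLinear g h₂ +
      evalLinear g h₁ * (MvPolynomial.aeval g q₂ + (p : T p K n) ^ j * evalLinear g h₂)), ?_⟩
  rw [hprod, map_add, hp, map_add (evalLinear g) (T.ofPoly p K k q₁),
    map_add (evalLinear g) (T.ofPoly p K k q₂), hp, hp, evalLinear_ofPoly, evalLinear_ofPoly,
    evalLinear_ofPoly, map_mul (MvPolynomial.aeval g)]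
  ring

/-- The evaluation homomorphism `T_k^† → T_n^†`, `ξ_i ↦ g_i`. The `g_i` are arbitrary. -/
def T.eval (g : Fin k → T p K n) : T p K k →ₐ[RInt K] T p K n :=
  AlgHom.ofLinearMap (evalLinear g)
    (by rw [← map_one (T.ofPoly p K k), evalLinear_ofPoly, map_one]) (evalLinear_mul g)

theorem T.eval_X (g : Fin k → T p K n) (i : Fin k) : T.eval g (T.X p K i) = g i := by
  change evalLinear g _ = _
  rw [T.X, evalLinear_ofPoly, MvPolynomial.aeval_X]

end Eval

/-! ### Homomorphisms and derivations on `T_n^†` -/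

section Universal

variable {p : ℕ} [hp : Fact p.Prime] {K : Type*} [NormedField K] [IsUltrametricDist K] {n : ℕ}
  [NormedAlgebra ℚ_[p] K] [FiniteDimensional ℚ_[p] K]
  {A : Type*} [CommRing A] [Algebra (RInt K) A]

/-- Values of the variables in a w.c.f.g. algebra can be prescribed arbitrarily. -/
theorem Presentation.exists_algHom (P : Presentation p K A) (a : Fin n → A) :
    ∃ φ : T p K n →ₐ[RInt K] A, ∀ i, φ (T.X p K i) = a i := by
  have : CompleteSpace K := FiniteDimensional.complete ℚ_[p] K
  have := RInt.completeSpace (K := K)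
  choose g hg using fun i => P.surjective (a i)
  exact ⟨P.toHom.comp (T.eval g), fun i => by rw [AlgHom.comp_apply, T.eval_X, hg]⟩

theorem Presentation.algHom_ext (P : Presentation p K A) {φ ψ : T p K n →ₐ[RInt K] A}
    (h : ∀ i, φ (T.X p K i) = ψ (T.X p K i)) : φ = ψ := by
  have hpoly : φ.comp (T.ofPoly p K n) = ψ.comp (T.ofPoly p K n) := MvPolynomial.algHom_ext h
  have h0 : ((φ : T p K n →+ A) - (ψ : T p K n →+ A)) = 0 :=
    P.addMonoidHom_eq_zero (M := A) fun q => sub_eq_zero.2 (AlgHom.congr_fun hpoly q)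
  ext1 f
  exact sub_eq_zero.1 (DFunLike.congr_fun h0 f)

/-- An `R`-derivation from `T_n^†` to a finite module over a w.c.f.g. algebra is determined by its
values on the variables. -/
theorem Presentation.derivation_eq_zero (P : Presentation p K A) {M : Type*} [AddCommGroup M]
    [Module A M] [Module (RInt K) M] [Module.Finite A M] (φ : T p K n →ₐ[RInt K] A)
    (L : T p K n →ₗ[RInt K] M) (hL : ∀ f g, L (f * g) = φ f • L g + φ g • L f)
    (hX : ∀ i, L (T.X p K i) = 0) : L = 0 := by
  have h1 : L 1 = 0 := by simpa using hL 1 1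
  have h0 : L.toAddMonoidHom = 0 := P.addMonoidHom_eq_zero fun q => by
    change L _ = 0
    induction q using MvPolynomial.induction_on with
    | C c =>
      have : T.ofPoly p K n (MvPolynomial.C c) = c • 1 := by
        rw [← Algebra.algebraMap_eq_smul_one]
        exact (T.ofPoly p K n).commutes c
      rw [this, map_smul, h1, smul_zero]
    | add q₁ q₂ h₁ h₂ => rw [map_add, map_add, h₁, h₂, add_zero]
    | mul_X q i h =>
      rw [map_mul, hL, h, smul_zero, add_zero]
      exact (congrArg _ (hX i)).trans (smul_zero _)
  ext1 f
  exact DFunLike.congr_fun h0 f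

end Universal

section PartialDerivatives

variable {p : ℕ} [hp : Fact p.Prime] {K : Type*} [NormedField K] [IsUltrametricDist K] {n : ℕ}

theorem Overconvergent.pderiv {f : MvPowerSeries (Fin n) (RInt K)} (hf : Overconvergent p K f)
    (i : Fin n) : Overconvergent p K (MvPowerSeries.pderiv (RInt K) i f) := by
  obtain ⟨ε, hε, hf⟩ := hf
  have hp1 := (one_lt_cast_prime p).le
  have hinj : Function.Injective fun v : Fin n →₀ ℕ => v + Finsupp.single i 1 :=
    add_left_injective _
  refine ⟨ε, hε, squeeze_zero (fun v => by positivity) (fun v => ?_)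
    (hf.comp hinj.tendsto_cofinite)⟩
  rw [MvPowerSeries.coeff_pderiv, RInt.norm_mul]
  refine mul_le_mul (mul_le_of_le_one_right (norm_nonneg _) (RInt.norm_le_one _)) ?_
    (by positivity) (norm_nonneg _)
  refine Real.rpow_le_rpow_of_exponent_le hp1 (mul_le_mul_of_nonneg_left ?_ hε.le)
  rw [map_add]
  exact_mod_cast Nat.le_add_right _ _

variable (p K) in
/-- The partial derivative `∂/∂ξ_i` on `T_n^†`. -/
def T.pderiv (i : Fin n) : T p K n →ₗ[RInt K] T p K n :=
  ((MvPowerSeries.pderiv (RInt K) i).toLinearMap ∘ₗ (T p K n).val.toLinearMap).codRestrict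
    (Subalgebra.toSubmodule (T p K n)) fun f => f.2.pderiv i

theorem T.coe_pderiv (i : Fin n) (f : T p K n) :
    (T.pderiv p K i f : MvPowerSeries (Fin n) (RInt K)) = MvPowerSeries.pderiv (RInt K) i f.1 := rfl

theorem T.pderiv_mul (i : Fin n) (f g : T p K n) :
    T.pderiv p K i (f * g) = f * T.pderiv p K i g + g * T.pderiv p K i f :=
  Subtype.ext ((MvPowerSeries.pderiv (RInt K) i).leibniz f.1 g.1)

theorem T.pderiv_X (i j : Fin n) : T.pderiv p K i (T.X p K j) = if j = i then 1 else 0 := by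
  apply Subtype.ext
  rw [T.coe_pderiv, T.coe_X]
  split_ifs with h
  · rw [h, MvPowerSeries.pderiv_X_self]
    rfl
  · rw [MvPowerSeries.pderiv_X_of_ne h]
    rfl

end PartialDerivatives

/-! ### The diagonal homomorphism -/

section Diagonal

variable {p : ℕ} [hp : Fact p.Prime] {K : Type*} [NormedField K] [IsUltrametricDist K]
  {A : Type*} [CommRing A] [Algebra (RInt K) A]

theorem DaggerTensor.mk_surjective (P Q : Presentation p K A) :
    Function.Surjective (DaggerTensor.mk P Q) :=
  Ideal.Quotient.mkₐ_surjective _ _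

/-- The dagger completed tensor product is itself w.c.f.g. -/
def DaggerTensor.presentation (P Q : Presentation p K A) : Presentation p K (DaggerTensor P Q) :=
  ⟨P.n + Q.n, DaggerTensor.mk P Q, DaggerTensor.mk_surjective P Q⟩

theorem DaggerTensor.mk_X_castAdd (P Q : Presentation p K A) (i : Fin P.n) :
    DaggerTensor.mk P Q (T.X p K (Fin.castAdd Q.n i)) = inl P Q (P.toHom (T.X p K i)) := by
  rw [inl_toHom, T.rename_X]
  rfl

theorem DaggerTensor.mk_X_natAdd (P Q : Presentation p K A) (j : Fin Q.n) :
    DaggerTensor.mk P Q (T.X p K (Fin.natAdd P.n j)) = inr P Q (Q.toHom (T.X p K j)) := by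
  rw [inr_toHom, T.rename_X]
  rfl

theorem tensorIdeal_le {P Q : Presentation p K A} {J : Ideal (T p K (P.n + Q.n))}
    (h₁ : ∀ f, P.toHom f = 0 → T.rename p K (Fin.castAddEmb Q.n) f ∈ J)
    (h₂ : ∀ f, Q.toHom f = 0 → T.rename p K (Fin.natAddEmb P.n) f ∈ J) : tensorIdeal P Q ≤ J :=
  sup_le (Ideal.map_le_iff_le_comap.2 fun f hf => h₁ f hf)
    (Ideal.map_le_iff_le_comap.2 fun f hf => h₂ f hf)

variable [NormedAlgebra ℚ_[p] K] [FiniteDimensional ℚ_[p] K]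

theorem exists_isDiagonal (P Q : Presentation p K A) :
    ∃ m : DaggerTensor P Q →ₐ[RInt K] A, IsDiagonal m := by
  obtain ⟨φ, hφ⟩ := P.exists_algHom (n := P.n + Q.n)
    (Fin.addCases (fun i => P.toHom (T.X p K i)) fun j => Q.toHom (T.X p K j))
  have h₁ : φ.comp (T.rename p K (Fin.castAddEmb Q.n)) = P.toHom := P.algHom_ext fun i => by
    rw [AlgHom.comp_apply, T.rename_X, hφ]
    exact Fin.addCases_left i
  have h₂ : φ.comp (T.rename p K (Fin.natAddEmb P.n)) = Q.toHom := P.algHom_ext fun i => by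
    rw [AlgHom.comp_apply, T.rename_X, hφ]
    exact Fin.addCases_right i
  have hle : tensorIdeal P Q ≤ RingHom.ker φ := tensorIdeal_le
    (fun f hf => by rw [RingHom.mem_ker, ← AlgHom.comp_apply, h₁, hf])
    (fun f hf => by rw [RingHom.mem_ker, ← AlgHom.comp_apply, h₂, hf])
  let m : DaggerTensor P Q →ₐ[RInt K] A := Ideal.Quotient.liftₐ (tensorIdeal P Q) φ hle
  have hm : ∀ f, m (DaggerTensor.mk P Q f) = φ f := fun f => rfl
  refine ⟨m, fun b b' => ?_⟩
  obtain ⟨f, rfl⟩ := P.surjective b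
  obtain ⟨f', rfl⟩ := Q.surjective b'
  rw [map_mul, inl_toHom, inr_toHom, hm, hm, ← AlgHom.comp_apply, ← AlgHom.comp_apply, h₁, h₂]

theorem IsDiagonal.unique {P Q : Presentation p K A} {m m' : DaggerTensor P Q →ₐ[RInt K] A}
    (hm : IsDiagonal m) (hm' : IsDiagonal m') : m' = m := by
  have h : m'.comp (DaggerTensor.mk P Q) = m.comp (DaggerTensor.mk P Q) := by
    refine P.algHom_ext fun i => ?_
    rw [AlgHom.comp_apply, AlgHom.comp_apply]
    induction i using Fin.addCases with
    | left i => rw [DaggerTensor.mk_X_castAdd, hm.inl, hm'.inl]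
    | right j => rw [DaggerTensor.mk_X_natAdd, hm.inr, hm'.inr]
  ext1 x
  obtain ⟨f, rfl⟩ := DaggerTensor.mk_surjective P Q x
  exact AlgHom.congr_fun h f

end Diagonal

/-! ### Generation of the conormal module -/

section Generation

variable {p : ℕ} [hp : Fact p.Prime] {K : Type*} [NormedField K] [IsUltrametricDist K]
  {A : Type*} [CommRing A] [Algebra (RInt K) A]
  {P Q : Presentation p K A} {m : DaggerTensor P Q →ₐ[RInt K] A}

variable (P Q) in
/-- The ideal generated by the elements `1 ⊗ b - b ⊗ 1`. -/
def diagonalIdeal : Ideal (DaggerTensor P Q) :=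
  Ideal.span (Set.range fun b : A => inr P Q b - inl P Q b)

/-- Every polynomial `s` in the `a ⊗ 1` and `1 ⊗ b` is congruent to `μ(s) ⊗ 1` modulo the ideal of the
`1 ⊗ b - b ⊗ 1`, where `μ` is the diagonal homomorphism. -/
theorem mk_ofPoly_sub_mem (hm : IsDiagonal m) (q : MvPolynomial (Fin (P.n + Q.n)) (RInt K)) :
    DaggerTensor.mk P Q (T.ofPoly p K _ q) -
      inl P Q (m (DaggerTensor.mk P Q (T.ofPoly p K _ q))) ∈ diagonalIdeal P Q := by
  let π := Ideal.Quotient.mkₐ (RInt K) (diagonalIdeal P Q)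
  let ψ := (DaggerTensor.mk P Q).comp (T.ofPoly p K (P.n + Q.n))
  have h : π.comp ψ = (π.comp ((inl P Q).comp m)).comp ψ := by
    refine MvPolynomial.algHom_ext fun i => ?_
    change π (DaggerTensor.mk P Q (T.X p K i)) = π (inl P Q (m (DaggerTensor.mk P Q (T.X p K i))))
    induction i using Fin.addCases with
    | left i => rw [DaggerTensor.mk_X_castAdd, hm.inl]
    | right j =>
      rw [DaggerTensor.mk_X_natAdd, hm.inr]
      exact Ideal.Quotient.eq.2 (Ideal.subset_span ⟨_, rfl⟩)
  exact Ideal.Quotient.eq.1 (AlgHom.congr_fun h q)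

theorem Conormal.mk_surjective (m : DaggerTensor P Q →ₐ[RInt K] A) :
    Function.Surjective (Conormal.mk m) :=
  Ideal.toCotangent_surjective _

variable [NormedAlgebra ℚ_[p] K] [FiniteDimensional ℚ_[p] K]

/-- The kernel `I` of the diagonal homomorphism is generated by the `1 ⊗ b - b ⊗ 1`. The ideal `I₀`
of these elements satisfies `I ≤ I₀ + pI`, since polynomials are dense, so that Nakayama's lemma
applies. -/
theorem ker_le_diagonalIdeal (hm : IsDiagonal m) : RingHom.ker m ≤ diagonalIdeal P Q := by
  have := (DaggerTensor.presentation P Q).isNoetherianRing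
  refine Submodule.le_of_le_smul_of_le_jacobson_bot
    (I := Ideal.span {(p : DaggerTensor P Q)}) (IsNoetherian.noetherian _)
    ((Ideal.span_singleton_le_iff_mem _).2 (DaggerTensor.presentation P Q).natCast_mem_jacobson)
    fun x hx => ?_
  obtain ⟨f, rfl⟩ := DaggerTensor.mk_surjective P Q x
  obtain ⟨q, h, rfl⟩ := T.exists_ofPoly_add f 1
  have key : DaggerTensor.mk P Q (T.ofPoly p K _ q + (p : T p K _) ^ 1 * h) =
      (DaggerTensor.mk P Q (T.ofPoly p K _ q) -
        inl P Q (m (DaggerTensor.mk P Q (T.ofPoly p K _ q)))) +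
      (p : DaggerTensor P Q) * (DaggerTensor.mk P Q h - inl P Q (m (DaggerTensor.mk P Q h))) := by
    have h0 := congrArg (inl P Q) (RingHom.mem_ker.1 hx)
    simp only [map_add, map_mul, map_natCast, pow_one, map_zero] at h0 ⊢
    linear_combination h0
  rw [key]
  refine Submodule.add_mem_sup (mk_ofPoly_sub_mem hm q) (Submodule.smul_mem_smul
    (Ideal.mem_span_singleton_self _) ?_)
  rw [RingHom.mem_ker, map_sub, hm.inl, sub_self]

theorem Conormal.span_range_d (hm : IsDiagonal m) :
    Submodule.span A (Set.range (Conormal.d hm)) = ⊤ := by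
  have h : ∀ y ∈ diagonalIdeal P Q, ∃ hy : y ∈ RingHom.ker m,
      Conormal.mk m ⟨y, hy⟩ ∈ Submodule.span A (Set.range (Conormal.d hm)) := by
    intro y hy
    induction hy using Submodule.span_induction with
    | mem x hx =>
      obtain ⟨b, rfl⟩ := hx
      exact ⟨hm.sub_mem b, Submodule.subset_span ⟨b, rfl⟩⟩
    | zero => exact ⟨Ideal.zero_mem _, by
        rw [show (⟨0, Ideal.zero_mem _⟩ : RingHom.ker m) = 0 from rfl, map_zero]
        exact Submodule.zero_mem _⟩
    | add x y _ _ hx hy =>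
      obtain ⟨hx, hx'⟩ := hx
      obtain ⟨hy, hy'⟩ := hy
      refine ⟨Ideal.add_mem _ hx hy, ?_⟩
      rw [show (⟨x + y, Ideal.add_mem _ hx hy⟩ : RingHom.ker m) = ⟨x, hx⟩ + ⟨y, hy⟩ from rfl,
        map_add]
      exact Submodule.add_mem _ hx' hy'
    | smul t x _ hx =>
      obtain ⟨hx, hx'⟩ := hx
      refine ⟨Ideal.mul_mem_left _ t hx, ?_⟩
      rw [show (⟨t • x, Ideal.mul_mem_left _ t hx⟩ : RingHom.ker m) = t • ⟨x, hx⟩ from rfl,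
        map_smul, ← Conormal.smul_eq hm]
      exact Submodule.smul_mem _ _ hx'
  rw [eq_top_iff]
  intro x _
  obtain ⟨⟨y, hy⟩, rfl⟩ := Conormal.mk_surjective m x
  exact (h y (ker_le_diagonalIdeal hm hy)).2

theorem Conormal.finite (hm : IsDiagonal m) : Module.Finite A (Conormal m) := by
  have := (DaggerTensor.presentation P Q).isNoetherianRing
  have hfin : Module.Finite (DaggerTensor P Q) (Conormal m) :=
    Module.Finite.of_surjective (Conormal.mk m) (Conormal.mk_surjective m)
  obtain ⟨s, hs⟩ := hfin.fg_top
  refine ⟨s, eq_top_iff.2 fun x _ => ?_⟩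
  have hx : x ∈ Submodule.span (DaggerTensor P Q) (s : Set (Conormal m)) := hs ▸ Submodule.mem_top
  induction hx using Submodule.span_induction with
  | mem x hx => exact Submodule.subset_span hx
  | zero => exact Submodule.zero_mem _
  | add x y _ _ hx hy => exact Submodule.add_mem _ (hx trivial) (hy trivial)
  | smul t x _ hx =>
    rw [← Conormal.smul_eq hm]
    exact Submodule.smul_mem _ _ (hx trivial)

end Generation

/-! ### The universal property -/

section UniversalProperty

variable {p : ℕ} [hp : Fact p.Prime] {K : Type*} [NormedField K] [IsUltrametricDist K]
  {A : Type*} [CommRing A] [Algebra (RInt K) A]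
  {P Q : Presentation p K A} {m : DaggerTensor P Q →ₐ[RInt K] A}
  {M : Type*} [AddCommGroup M] [Module A M] [Module (RInt K) M] [IsScalarTower (RInt K) A M]

/-- For a derivation `δ : A → M`, the map `f ↦ ∑_j (∂f/∂η_j) δ(y_j)` on `T_{n+m}^†`, where `η_j` are
the last `m` variables and `y_j ∈ A` their images. -/
def relativeDerivation (m : DaggerTensor P Q →ₐ[RInt K] A) (δ : Derivation (RInt K) A M) :
    T p K (P.n + Q.n) →ₗ[RInt K] M :=
  ∑ j : Fin Q.n, ((LinearMap.toSpanSingleton A M (δ (Q.toHom (T.X p K j)))).restrictScalars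
    (RInt K)) ∘ₗ (m.comp (DaggerTensor.mk P Q)).toLinearMap ∘ₗ T.pderiv p K (Fin.natAdd P.n j)

variable (δ : Derivation (RInt K) A M)

theorem relativeDerivation_apply (f : T p K (P.n + Q.n)) :
    relativeDerivation m δ f = ∑ j : Fin Q.n,
      m (DaggerTensor.mk P Q (T.pderiv p K (Fin.natAdd P.n j) f)) • δ (Q.toHom (T.X p K j)) := by
  simp [relativeDerivation]

theorem relativeDerivation_mul (f g : T p K (P.n + Q.n)) :
    relativeDerivation m δ (f * g) = m (DaggerTensor.mk P Q f) • relativeDerivation m δ g +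
      m (DaggerTensor.mk P Q g) • relativeDerivation m δ f := by
  simp only [relativeDerivation_apply, T.pderiv_mul, map_add, map_mul, add_smul, mul_smul,
    Finset.sum_add_distrib, Finset.smul_sum]

theorem relativeDerivation_X_castAdd (i : Fin P.n) :
    relativeDerivation m δ (T.X p K (Fin.castAdd Q.n i)) = 0 := by
  rw [relativeDerivation_apply]
  refine Finset.sum_eq_zero fun j _ => ?_
  rw [T.pderiv_X, if_neg, map_zero, map_zero, zero_smul]
  intro h
  have := congrArg Fin.val h
  simp only [Fin.val_castAdd, Fin.val_natAdd] at this
  omega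

theorem relativeDerivation_X_natAdd (j : Fin Q.n) :
    relativeDerivation m δ (T.X p K (Fin.natAdd P.n j)) = δ (Q.toHom (T.X p K j)) := by
  rw [relativeDerivation_apply, Finset.sum_eq_single j]
  · rw [T.pderiv_X, if_pos rfl, map_one, map_one, one_smul]
  · intro k _ hk
    rw [T.pderiv_X, if_neg fun h => hk (Fin.natAdd_injective _ _ h).symm, map_zero, map_zero,
      zero_smul]
  · exact fun h => absurd (Finset.mem_univ j) h

variable [NormedAlgebra ℚ_[p] K] [FiniteDimensional ℚ_[p] K] [Module.Finite A M]

theorem relativeDerivation_rename_castAdd (hm : IsDiagonal m) (f : T p K P.n) :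
    relativeDerivation m δ (T.rename p K (Fin.castAddEmb Q.n) f) = 0 := by
  have h := P.derivation_eq_zero P.toHom
    (relativeDerivation m δ ∘ₗ (T.rename p K (Fin.castAddEmb Q.n)).toLinearMap)
    (fun f g => by
      change relativeDerivation m δ (T.rename p K (Fin.castAddEmb Q.n) (f * g)) = _
      rw [map_mul, relativeDerivation_mul, ← inl_toHom, ← inl_toHom, hm.inl, hm.inl]
      rfl)
    (fun i => by
      change relativeDerivation m δ (T.rename p K (Fin.castAddEmb Q.n) (T.X p K i)) = _
      rw [T.rename_X]
      exact relativeDerivation_X_castAdd δ i)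
  exact LinearMap.congr_fun h f

theorem relativeDerivation_rename_natAdd (hm : IsDiagonal m) (f : T p K Q.n) :
    relativeDerivation m δ (T.rename p K (Fin.natAddEmb P.n) f) = δ (Q.toHom f) := by
  have h := P.derivation_eq_zero Q.toHom
    (relativeDerivation m δ ∘ₗ (T.rename p K (Fin.natAddEmb P.n)).toLinearMap -
      (δ : A →ₗ[RInt K] M) ∘ₗ Q.toHom.toLinearMap)
    (fun f g => by
      change relativeDerivation m δ (T.rename p K (Fin.natAddEmb P.n) (f * g)) -
        δ (Q.toHom (f * g)) = Q.toHom f • (relativeDerivation m δ (T.rename p K _ g) -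
        δ (Q.toHom g)) + Q.toHom g • (relativeDerivation m δ (T.rename p K _ f) - δ (Q.toHom f))
      rw [map_mul, relativeDerivation_mul, ← inr_toHom, ← inr_toHom, hm.inr, hm.inr, map_mul,
        δ.leibniz, smul_sub, smul_sub]
      abel)
    (fun i => by
      change relativeDerivation m δ (T.rename p K (Fin.natAddEmb P.n) (T.X p K i)) -
        δ (Q.toHom (T.X p K i)) = 0
      rw [T.rename_X, sub_eq_zero]
      exact relativeDerivation_X_natAdd δ i)
  exact sub_eq_zero.1 (LinearMap.congr_fun h f)

theorem relativeDerivation_eq_zero (hm : IsDiagonal m) {f : T p K (P.n + Q.n)}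
    (hf : f ∈ tensorIdeal P Q) : relativeDerivation m δ f = 0 := by
  let J : Ideal (T p K (P.n + Q.n)) :=
    { carrier := {f | m (DaggerTensor.mk P Q f) = 0 ∧ relativeDerivation m δ f = 0}
      zero_mem' := by simp
      add_mem' := fun ha hb => by
        simp only [Set.mem_ofPred_eq] at ha hb ⊢
        simp [ha.1, ha.2, hb.1, hb.2]
      smul_mem' := fun c x hx => by
        simp only [Set.mem_ofPred_eq] at hx ⊢
        rw [smul_eq_mul, relativeDerivation_mul, map_mul, map_mul, hx.1, hx.2]
        simp }
  have hle : tensorIdeal P Q ≤ J := tensorIdeal_le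
    (fun f hf => ⟨by rw [← inl_toHom, hm.inl, hf], relativeDerivation_rename_castAdd δ hm f⟩)
    (fun f hf => ⟨by rw [← inr_toHom, hm.inr, hf], by
      rw [relativeDerivation_rename_natAdd δ hm f, hf, map_zero]⟩)
  exact (hle hf).2

/-- The derivation on `A ⊗̂† A` over the diagonal homomorphism that vanishes on `A ⊗ 1` and extends
`δ` on `1 ⊗ A`. -/
theorem exists_extend_derivation (hm : IsDiagonal m) :
    ∃ D : DaggerTensor P Q →+ M, (∀ s t, D (s * t) = m s • D t + m t • D s) ∧
      (∀ b, D (inl P Q b) = 0) ∧ ∀ b, D (inr P Q b) = δ b := by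
  let D : DaggerTensor P Q →+ M :=
    AddMonoidHom.liftOfSurjective (DaggerTensor.mk P Q : T p K (P.n + Q.n) →+ DaggerTensor P Q)
      (DaggerTensor.mk_surjective P Q) ⟨(relativeDerivation m δ).toAddMonoidHom, fun f hf =>
        relativeDerivation_eq_zero δ hm (Ideal.Quotient.eq_zero_iff_mem.1 hf)⟩
  have hD : ∀ f, D (DaggerTensor.mk P Q f) = relativeDerivation m δ f := fun f =>
    AddMonoidHom.liftOfRightInverse_comp_apply _ _ _ _ f
  refine ⟨D, fun s t => ?_, fun b => ?_, fun b => ?_⟩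
  · obtain ⟨f, rfl⟩ := DaggerTensor.mk_surjective P Q s
    obtain ⟨g, rfl⟩ := DaggerTensor.mk_surjective P Q t
    rw [← map_mul, hD, hD, hD, relativeDerivation_mul]
  · obtain ⟨f, rfl⟩ := P.surjective b
    rw [inl_toHom, hD, relativeDerivation_rename_castAdd δ hm]
  · obtain ⟨f, rfl⟩ := Q.surjective b
    rw [inr_toHom, hD, relativeDerivation_rename_natAdd δ hm]

theorem Conormal.exists_compDer_eq (hm : IsDiagonal m) :
    ∃ φ : Conormal m →ₗ[A] M, φ.compDer (Conormal.d hm) = δ := by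
  obtain ⟨D, hmul, hl, hr⟩ := exists_extend_derivation δ hm
  have hsq : ∀ y ∈ RingHom.ker m ^ 2, D y = 0 := by
    intro y hy
    rw [pow_two] at hy
    induction hy using Submodule.mul_induction_on' with
    | mem_mul_mem s hs t ht =>
      rw [hmul, RingHom.mem_ker.1 hs, RingHom.mem_ker.1 ht, zero_smul, zero_smul, add_zero]
    | add x _ y _ hx hy => rw [map_add, hx, hy, add_zero]
  let φ : Conormal m →+ M :=
    AddMonoidHom.liftOfSurjective (Conormal.mk m).toAddMonoidHom (Conormal.mk_surjective m)
      ⟨D.comp (RingHom.ker m).subtype.toAddMonoidHom, fun y hy =>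
        hsq y ((Ideal.toCotangent_eq_zero _ y).1 hy)⟩
  have hφ : ∀ y : RingHom.ker m, φ (Conormal.mk m y) = D y := fun y =>
    AddMonoidHom.liftOfRightInverse_comp_apply _ _ _ _ y
  refine ⟨{ φ with map_smul' := fun a x => ?_ }, ?_⟩
  · obtain ⟨y, rfl⟩ := Conormal.mk_surjective m x
    change φ (a • Conormal.mk m y) = a • φ (Conormal.mk m y)
    rw [Conormal.smul_def, ← map_smul, hφ, hφ]
    change D (inl P Q a * y) = _
    rw [hmul, hm.inl, RingHom.mem_ker.1 y.2, zero_smul, add_zero]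
  · ext b
    change φ (Conormal.d hm b) = δ b
    rw [Conormal.d_apply, hφ, map_sub, hl, hr, sub_zero]

end UniversalProperty

end DaggerAlg

end

theorem proposition13 (p : ℕ) [Fact p.Prime]
    (K : Type u) [NormedField K] [IsUltrametricDist K] [NormedAlgebra ℚ_[p] K]
    [FiniteDimensional ℚ_[p] K]
    (A : Type v) [CommRing A] [Algebra (DaggerAlg.RInt K) A]
    (P Q : DaggerAlg.Presentation p K A) :
    ∃ (m : DaggerAlg.DaggerTensor P Q →ₐ[DaggerAlg.RInt K] A) (hm : DaggerAlg.IsDiagonal m),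
      (∀ m' : DaggerAlg.DaggerTensor P Q →ₐ[DaggerAlg.RInt K] A,
        DaggerAlg.IsDiagonal m' → m' = m) ∧
      DaggerAlg.IsModuleOfDifferentials.{u, v, u, w} (DaggerAlg.Conormal.d hm) := by
  obtain ⟨m, hm⟩ := DaggerAlg.exists_isDiagonal P Q
  refine ⟨m, hm, fun m' hm' => hm.unique hm', DaggerAlg.Conormal.finite hm, ?_⟩
  intro M _ _ _ _ hM
  refine ⟨fun φ ψ h => ?_, fun δ => DaggerAlg.Conormal.exists_compDer_eq δ hm⟩
  exact LinearMap.ext_on_range (DaggerAlg.Conormal.span_range_d hm) fun b =>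
    Derivation.congr_fun h b
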